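/- An instance of (not necessarily metric) $k$-Median consists of a finite bipartite graph $G=(U,W,E)$ with $E\subseteq U\times W$ (centers $U$, customers $W$), a cost $c_{ij}\ge 0$ for each edge $(i,j)\in E$, and a positive integer $k$; put $c_{ij}=\infty$ for $(i,j)\in (U\times W)\setminus E$. The cost of a set $C\subseteq U$ is $c(C)=\sum_{j\in W}\min_{i\in C}c_{ij}$ (the minimum over the empty set being $\infty$). Let $n=|W|$, $$T=\Big\lceil k\ln\frac{n^2}{2k(2k+1)}\Big\rceil ,\qquad \alpha_{kn}=\frac{T}{k}+2 .$$ An $\alpha$-size-approximate solution is a set $C\subseteq U$ with $|C|\le \alpha k$ such that $c(C)\le c(D)$ for every $D\subseteq U$ with $|D|=k$. **Theorem.** There is a polynomial-time algorithm that, for every instance with $n\ge 1$ and either $k=1$ or $1\le k\le n/2$, returns an $\alpha_{kn}$-size-approximate solution. Here polynomial time is meant in the following strong sense. The algorithm is a single program for a random access machine with arrays of natural numbers (with addition, truncated subtraction, comparison, and use as indices) and arrays of field elements (with conversion of natural numbers to field elements, $+,-,\times,\div$ and comparison). The input is the list of edges (center, customer, cost), in any order, together with $|U|$, $|W|$, $|E|$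 and $k$. There is one polynomial $P$ such that: (i) for arbitrary real costs, the program is correct and halts after at most $P(|U|+|W|+|E|)$ elementary operations, each counted as one step (exact real arithmetic); (ii) for rational costs, the same program is correct and halts within time $P(L)$ when each elementary operation is charged the number of bits of its result, up to additive constants (logarithmic cost), where $L=|U|+|W|+\sum_{(i,j)\in E}\mathrm{bits}(c_{ij})$. -/

import Mathlib

/-! ### The problem -/

/-- A (not necessarily metric) `k`-Median instance with costs in `K`: a bipartite graph between
centers and customers, with a nonnegative cost on every edge. Values of `cost` outside `edges`
are irrelevant. -/
structure KMedian (K : Type) [Field K] [LinearOrder K] where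
  centers : ℕ
  customers : ℕ
  edges : Finset (Fin centers × Fin customers)
  cost : Fin centers → Fin customers → K
  cost_nonneg : ∀ p ∈ edges, 0 ≤ cost p.1 p.2

namespace KMedian

variable {K : Type} [Field K] [LinearOrder K]

/-- The cost of assigning customer `j` to center `i`, equal to `∞` on non-edges. -/
def assignCost (I : KMedian K) (i : Fin I.centers) (j : Fin I.customers) : WithTop K :=
  if (i, j) ∈ I.edges then (I.cost i j : WithTop K) else ⊤

/-- The cost of a set of centers: every customer is assigned to its closest center in `C`
(the minimum over the empty set is `∞`). -/
def setCost (I : KMedian K) (C : Finset (Fin I.centers)) : WithTop K :=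
  ∑ j : Fin I.customers, C.inf (fun i => I.assignCost i j)

/-- `C` is an `α`-size-approximate solution for the parameter `k`. -/
def IsSizeApproxSolution (I : KMedian K) (k : ℕ) (α : ℝ) (C : Finset (Fin I.centers)) : Prop :=
  (C.card : ℝ) ≤ α * k ∧
    ∀ D : Finset (Fin I.centers), D.card = k → I.setCost C ≤ I.setCost D

/-- The size of an instance: its number of vertices and edges. -/
def size (I : KMedian K) : ℕ := I.centers + I.customers + I.edges.card

end KMedian

/-- The number `T = ⌈k ln (n² / (2k(2k+1)))⌉`. -/
noncomputable def kMedianT (k n : ℕ) : ℤ :=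
  ⌈(k : ℝ) * Real.log ((n : ℝ) ^ 2 / (2 * k * (2 * k + 1)))⌉

/-- The size-approximation ratio `α_{kn} = T / k + 2`. -/
noncomputable def kMedianAlpha (k n : ℕ) : ℝ := (kMedianT k n : ℝ) / k + 2

/-! ### The machine model

A random access machine with finitely many arrays (a program mentions finitely many array names)
of natural numbers, used for counting and indexing, and finitely many arrays of elements of an
ordered field `K`. Programs are independent of `K`. There is no rounding operation
from `K` to the natural numbers, and no multiplication of natural numbers. -/

namespace FieldRAM

/-- Contents of the memory: `nat a i` and `fld a i` are the entries with index `i` of the arrays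
with name `a`. -/
structure State (K : Type) where
  nat : ℕ → ℕ → ℕ
  fld : ℕ → ℕ → K

/-- Expressions with natural number values. -/
inductive NatExpr
  | lit (c : ℕ)
  | get (a : ℕ) (i : NatExpr)
  | add (x y : NatExpr)
  | sub (x y : NatExpr)

/-- Expressions with values in the field. -/
inductive FldExpr
  | ofNat (x : NatExpr)
  | get (a : ℕ) (i : NatExpr)
  | add (x y : FldExpr)
  | sub (x y : FldExpr)
  | mul (x y : FldExpr)
  | div (x y : FldExpr)

/-- Tests: comparisons of two natural numbers or of two field elements. -/
inductive Test
  | natLe (x y : NatExpr)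
  | fldLe (x y : FldExpr)

/-- Programs. -/
inductive Prog
  | skip
  | setNat (a : ℕ) (i e : NatExpr)
  | setFld (a : ℕ) (i : NatExpr) (e : FldExpr)
  | seq (p q : Prog)
  | ite (b : Test) (p q : Prog)
  | loop (b : Test) (p : Prog)

/-- The price of an elementary operation, as a function of the value that it produces. -/
structure Pricing (K : Type) where
  nat : ℕ → ℕ
  fld : K → ℕ

/-- Unit cost: every elementary operation is one step. -/
def unitPricing (K : Type) : Pricing K := ⟨fun _ => 1, fun _ => 1⟩

/-- The number of bits of a rational number (at least `1`). -/
def ratBits (q : ℚ) : ℕ := Nat.size q.num.natAbs + Nat.size q.den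

/-- Logarithmic cost: an elementary operation costs the number of bits of its result.
(Its operands are themselves results of operations that have been charged.) -/
def bitPricing : Pricing ℚ := ⟨fun x => Nat.size x + 1, fun q => ratBits q + 1⟩

variable {K : Type} [Field K] [LinearOrder K]

/-- The value of a natural number expression (subtraction is truncated at `0`). -/
def NatExpr.eval (s : State K) : NatExpr → ℕ
  | .lit c => c
  | .get a i => s.nat a (i.eval s)
  | .add x y => x.eval s + y.eval s
  | .sub x y => x.eval s - y.eval s

/-- The price of evaluating a natural number expression: the sum over all its operations. -/
def NatExpr.price (M : Pricing K) (s : State K) : NatExpr → ℕ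
  | .lit c => M.nat c
  | .get a i => i.price M s + M.nat (s.nat a (i.eval s))
  | .add x y => x.price M s + y.price M s + M.nat (x.eval s + y.eval s)
  | .sub x y => x.price M s + y.price M s + M.nat (x.eval s - y.eval s)

/-- The value of a field expression (a division by zero returns `0`). -/
def FldExpr.eval (s : State K) : FldExpr → K
  | .ofNat x => (x.eval s : K)
  | .get a i => s.fld a (i.eval s)
  | .add x y => x.eval s + y.eval s
  | .sub x y => x.eval s - y.eval s
  | .mul x y => x.eval s * y.eval s
  | .div x y => x.eval s / y.eval s

/-- The price of evaluating a field expression: the sum over all its operations. -/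
def FldExpr.price (M : Pricing K) (s : State K) : FldExpr → ℕ
  | .ofNat x => x.price M s + M.fld (x.eval s : K)
  | .get a i => i.price M s + M.fld (s.fld a (i.eval s))
  | .add x y => x.price M s + y.price M s + M.fld (x.eval s + y.eval s)
  | .sub x y => x.price M s + y.price M s + M.fld (x.eval s - y.eval s)
  | .mul x y => x.price M s + y.price M s + M.fld (x.eval s * y.eval s)
  | .div x y => x.price M s + y.price M s + M.fld (x.eval s / y.eval s)

/-- The truth value of a test. -/
def Test.holds (s : State K) : Test → Prop
  | .natLe x y => x.eval s ≤ y.eval s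
  | .fldLe x y => x.eval s ≤ y.eval s

/-- The price of a test. -/
def Test.price (M : Pricing K) (s : State K) : Test → ℕ
  | .natLe x y => x.price M s + y.price M s + 1
  | .fldLe x y => x.price M s + y.price M s + 1

/-- Overwrite one entry of a natural number array. -/
def State.setNat (s : State K) (a i v : ℕ) : State K :=
  { s with nat := Function.update s.nat a (Function.update (s.nat a) i v) }

/-- Overwrite one entry of a field array. -/
def State.setFld (s : State K) (a i : ℕ) (v : K) : State K :=
  { s with fld := Function.update s.fld a (Function.update (s.fld a) i v) }

/-- `Run M p s t s'`: started in the state `s`, the program `p` halts in the state `s'`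
after time `t`, where time is measured with the prices `M`. -/
inductive Run (M : Pricing K) : Prog → State K → ℕ → State K → Prop
  | skip (s : State K) : Run M .skip s 1 s
  | setNat (a : ℕ) (i e : NatExpr) (s : State K) :
      Run M (.setNat a i e) s (i.price M s + e.price M s + 1) (s.setNat a (i.eval s) (e.eval s))
  | setFld (a : ℕ) (i : NatExpr) (e : FldExpr) (s : State K) :
      Run M (.setFld a i e) s (i.price M s + e.price M s + 1) (s.setFld a (i.eval s) (e.eval s))
  | seq {p q : Prog} {s s' s'' : State K} {t t' : ℕ} :
      Run M p s t s' → Run M q s' t' s'' → Run M (.seq p q) s (t + t') s''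
  | iteTrue {b : Test} {p q : Prog} {s s' : State K} {t : ℕ} :
      b.holds s → Run M p s t s' → Run M (.ite b p q) s (b.price M s + t) s'
  | iteFalse {b : Test} {p q : Prog} {s s' : State K} {t : ℕ} :
      ¬ b.holds s → Run M q s t s' → Run M (.ite b p q) s (b.price M s + t) s'
  | loopTrue {b : Test} {p : Prog} {s s' s'' : State K} {t t' : ℕ} :
      b.holds s → Run M p s t s' → Run M (.loop b p) s' t' s'' →
        Run M (.loop b p) s (b.price M s + t + t') s''
  | loopFalse {b : Test} {p : Prog} {s : State K} :
      ¬ b.holds s → Run M (.loop b p) s (b.price M s) s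

end FieldRAM

namespace KMedian

open FieldRAM

/-- The number of bits of an instance with rational costs. -/
def bitSize (I : KMedian ℚ) : ℕ :=
  I.centers + I.customers + ∑ p ∈ I.edges, ratBits (I.cost p.1 p.2)

variable {K : Type} [Field K] [LinearOrder K]

/-- The initial state, for a list of the edges in some order: array `0` of naturals holds
the numbers of centers, customers and edges and the parameter `k`; arrays `1` and `2` hold
the center and the customer of each edge; array `0` of field elements holds the edge costs.
Everything else is zero. -/
def input (I : KMedian K) (k : ℕ) (enum : Fin I.edges.card ≃ I.edges) : State K where
  nat a x :=
    match a with
    | 0 => [I.centers, I.customers, I.edges.card, k].getD x 0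
    | 1 => if h : x < I.edges.card then ((enum ⟨x, h⟩ : Fin I.centers × Fin I.customers).1 : ℕ)
        else 0
    | 2 => if h : x < I.edges.card then ((enum ⟨x, h⟩ : Fin I.centers × Fin I.customers).2 : ℕ)
        else 0
    | _ => 0
  fld a x :=
    match a with
    | 0 => if h : x < I.edges.card then
        I.cost (enum ⟨x, h⟩ : Fin I.centers × Fin I.customers).1
          (enum ⟨x, h⟩ : Fin I.centers × Fin I.customers).2
        else 0
    | _ => 0

/-- The set of centers that is returned: array `3` of naturals is its indicator. -/
def output (I : KMedian K) (s : State K) : Finset (Fin I.centers) :=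
  Finset.univ.filter (fun i => s.nat 3 (i : ℕ) ≠ 0)

/-- On every instance with costs in `K`, with at least one customer and with `k = 1` or
`1 ≤ k ≤ n / 2`, and for every order of the edges in the input, the program `A` halts within
time `P (sz I)`, measured with the prices `M`,
and returns an `α k n`-size-approximate solution, where `n` is the number of customers. -/
def SizeApproximates (A : Prog) (α : ℕ → ℕ → ℝ) (M : Pricing K) (sz : KMedian K → ℕ)
    (P : Polynomial ℕ) : Prop :=
  ∀ (I : KMedian K) (k : ℕ) (enum : Fin I.edges.card ≃ I.edges),
    1 ≤ k → 1 ≤ I.customers → (k = 1 ∨ 2 * k ≤ I.customers) →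
    ∃ (t : ℕ) (s : State K), Run M A (I.input k enum) t s ∧ t ≤ P.eval (sz I) ∧
      I.IsSizeApproxSolution k (α k I.customers) (I.output s)

end KMedian

/-! Replace a missing edge by the cost `Z = 1 +` (sum of all edge costs). A set is feasible iff
every customer pays less than `Z`, and a feasible set has total below `Z`. So it suffices to compare
finite totals with a feasible `D` of size `k`. The excess of a customer is `n` times (its cost minus
its least possible cost). Let `G` be the total excess of `D`, and `w = (2k+1)(n-2k)`.

Fix a cap `g` and take `t` greedy steps for the potential `∑ min(g, excess)`. Averaging over the
members of `D` shows that one step shrinks (potential − `G`) by a factor `1 - 1/k`, so afterwards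
the potential is at most `G + (1-1/k)^t (n g - G)` (`Greedy.potential_le`). Then `2k` times serve a
customer of largest excess by its cheapest center. If the potential was below `(2k+1) g`, no excess
above `g` survives (`Fill.excess_le`). Since the served customers had at least as much excess as
what remains elsewhere, the remaining excess is at most `(1 - 2k/n)` times the potential
(`Fill.sum_excess_le`). For `n > 2k`, if `(1-1/k)^t n² ≤ 2k(2k+1)` and `n G / w < g ≤ n G / w + G /
n`, this is at most `G` (`total_le_of_cap`).

`G` is unknown, but the largest deviation `v` of a customer from its least cost under `D` satisfies
`n v ≤ G ≤ n² v`. Hence `v` is at most the length of the window for `g`, and some multiple `r v`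
with `r ≤ n² + 1` lies in it. As `v` is an edge cost minus a least cost, there are only polynomially
many caps to try (`exists_good_cap`). If `G = 0`, a cap below every positive excess works; if `n ≤
2k`, filling serves every customer optimally.

The least admissible `t` is at most `max(T, 0)` because `1 - 1/k ≤ exp(-1/k)` (`lt_kMedianT`), and
filling adds `min(n, 2k)` centers.

For the running time, each subroutine is verified together with a bound on its number of operations
(`Halts`). The program never divides and multiplies field elements only by naturals. On rational
input all field values therefore remain integers over one common denominator, with numerators that
gain polynomially few bits per operation. Thus a polynomial number of operations gives polynomial
logarithmic cost (`Run.exists_bit_run`). -/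

/-! ### Greedy selection with capped costs -/

/-- Assignment costs `c x j` (center `x`, customer `j < n`), bounded by `Z`, together with a cheapest
center `best j` of cost `low j` for every customer `j`. -/
structure CostMatrix (K : Type) [Field K] [LinearOrder K] where
  n : ℕ
  c : ℕ → ℕ → K
  Z : K
  low : ℕ → K
  best : ℕ → ℕ
  c_le : ∀ x j, c x j ≤ Z
  low_le : ∀ x, ∀ j < n, low j ≤ c x j
  c_best : ∀ j < n, c (best j) j = low j

namespace CostMatrix

variable {K : Type} [Field K] [LinearOrder K]

/-- The cost of customer `j` when the set `C` is open. -/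
def dist (A : CostMatrix K) (C : Finset ℕ) (j : ℕ) : K := C.fold min A.Z (fun x => A.c x j)

/-- The scaled excess of the cost of customer `j` over its least cost. -/
def excess (A : CostMatrix K) (C : Finset ℕ) (j : ℕ) : K := A.n * (A.dist C j - A.low j)

/-- The sum of the excesses, capped at `g`. -/
def potential (A : CostMatrix K) (g : K) (C : Finset ℕ) : K :=
  ∑ j ∈ Finset.range A.n, min g (A.excess C j)

/-- The total cost. -/
def total (A : CostMatrix K) (C : Finset ℕ) : K := ∑ j ∈ Finset.range A.n, A.dist C j

/-- `Greedy A U g t C`: the set `C` arises by `t` greedy choices of a center for the potential. -/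
inductive Greedy (A : CostMatrix K) (U : ℕ) (g : K) : ℕ → Finset ℕ → Prop
  | zero : Greedy A U g 0 ∅
  | step {t : ℕ} {C : Finset ℕ} {x : ℕ} : Greedy A U g t C →
      (∀ y < U, A.potential g (insert x C) ≤ A.potential g (insert y C)) →
      Greedy A U g (t + 1) (insert x C)

/-- `Fill A C₀ r C`: the set `C` arises from `C₀` by `r` times adding the cheapest center of a
customer with the largest excess. -/
inductive Fill (A : CostMatrix K) (C₀ : Finset ℕ) : ℕ → Finset ℕ → Prop
  | zero : Fill A C₀ 0 C₀
  | step {r j : ℕ} {C : Finset ℕ} : Fill A C₀ r C → j < A.n →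
      (∀ i < A.n, A.excess C i ≤ A.excess C j) → Fill A C₀ (r + 1) (insert (A.best j) C)

lemma Greedy.card_le {A : CostMatrix K} {U : ℕ} {g : K} {t : ℕ} {C : Finset ℕ}
    (h : A.Greedy U g t C) : C.card ≤ t := by
  induction h with
  | zero => simp
  | step _ _ ih => exact (Finset.card_insert_le _ _).trans (by omega)

lemma Fill.card_le {A : CostMatrix K} {C₀ C : Finset ℕ} {r : ℕ} (h : A.Fill C₀ r C) :
    C.card ≤ C₀.card + r := by
  induction h with
  | zero => simp
  | step _ _ _ ih => exact (Finset.card_insert_le _ _).trans (by omega)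

/-! ### Distances, excesses and the greedy analysis -/

variable (A : CostMatrix K)

lemma dist_insert (x : ℕ) (C : Finset ℕ) (j : ℕ) :
    A.dist (insert x C) j = min (A.c x j) (A.dist C j) := by
  simp [dist, Finset.fold_insert_idem]

lemma dist_empty (j : ℕ) : A.dist ∅ j = A.Z := by simp [dist]

lemma dist_le_Z (C : Finset ℕ) (j : ℕ) : A.dist C j ≤ A.Z := by
  simp [dist, Finset.fold_min_le]

lemma dist_le {C : Finset ℕ} {x : ℕ} (hx : x ∈ C) (j : ℕ) : A.dist C j ≤ A.c x j := by
  rw [dist, Finset.fold_min_le]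
  exact Or.inr ⟨x, hx, le_rfl⟩

lemma low_le_dist (C : Finset ℕ) {j : ℕ} (hj : j < A.n) : A.low j ≤ A.dist C j := by
  rw [dist, Finset.le_fold_min]
  exact ⟨(A.low_le 0 j hj).trans (A.c_le 0 j), fun x _ => A.low_le x j hj⟩

lemma dist_eq_Z_or (C : Finset ℕ) (j : ℕ) : A.dist C j = A.Z ∨ ∃ x ∈ C, A.dist C j = A.c x j := by
  induction C using Finset.induction_on with
  | empty => exact Or.inl (A.dist_empty j)
  | insert x C _ ih =>
    rw [dist_insert]
    rcases min_choice (A.c x j) (A.dist C j) with h | h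
    · exact Or.inr ⟨x, Finset.mem_insert_self _ _, h⟩
    · rcases ih with h' | ⟨y, hy, h'⟩
      · exact Or.inl (h.trans h')
      · exact Or.inr ⟨y, Finset.mem_insert_of_mem hy, h.trans h'⟩

lemma exists_dist_eq {C : Finset ℕ} (hC : C.Nonempty) (j : ℕ) : ∃ x ∈ C, A.dist C j = A.c x j := by
  rcases A.dist_eq_Z_or C j with h | h
  · obtain ⟨x, hx⟩ := hC
    exact ⟨x, hx, le_antisymm (A.dist_le hx j) (h ▸ A.c_le x j)⟩
  · exact h

variable [IsStrictOrderedRing K]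

lemma excess_nonneg (C : Finset ℕ) {j : ℕ} (hj : j < A.n) : 0 ≤ A.excess C j :=
  mul_nonneg (Nat.cast_nonneg _) (sub_nonneg.2 (A.low_le_dist C hj))

lemma excess_insert_le (x : ℕ) (C : Finset ℕ) (j : ℕ) : A.excess (insert x C) j ≤ A.excess C j := by
  unfold excess
  rw [dist_insert]
  gcongr
  exact min_le_right _ _

omit [IsStrictOrderedRing K] in
lemma excess_insert_best (C : Finset ℕ) {j : ℕ} (hj : j < A.n) :
    A.excess (insert (A.best j) C) j = 0 := by
  unfold excess
  rw [dist_insert, A.c_best j hj, min_eq_left (A.low_le_dist C hj), sub_self, mul_zero]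

omit [IsStrictOrderedRing K] in
lemma sum_excess (C : Finset ℕ) : ∑ j ∈ Finset.range A.n, A.excess C j =
    A.n * (A.total C - ∑ j ∈ Finset.range A.n, A.low j) := by
  rw [total, ← Finset.sum_sub_distrib, Finset.mul_sum]
  rfl

/-- Argue customer by customer: adding its nearest center in `D` brings its excess down to at most
its excess under `D`, and each of the other `|D| - 1` additions does not increase its capped excess.
-/
lemma sum_potential_insert_le (g : K) (C : Finset ℕ) {D : Finset ℕ} (hD : D.Nonempty) :
    ∑ y ∈ D, A.potential g (insert y C) ≤
      (D.card - 1 : K) * A.potential g C + ∑ j ∈ Finset.range A.n, A.excess D j := by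
  unfold potential
  rw [Finset.sum_comm, Finset.mul_sum, ← Finset.sum_add_distrib]
  refine Finset.sum_le_sum fun j _ => ?_
  obtain ⟨x, hx, hxj⟩ := A.exists_dist_eq hD j
  rw [← Finset.add_sum_erase D _ hx, add_comm]
  refine add_le_add ?_ ?_
  · have : ((D.erase x).card : K) = D.card - 1 := by
      rw [Finset.card_erase_of_mem hx, Nat.cast_sub (Finset.card_pos.2 hD), Nat.cast_one]
    rw [← this, ← nsmul_eq_mul]
    exact Finset.sum_le_card_nsmul _ _ _ fun y _ => min_le_min_left _ (A.excess_insert_le y C j)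
  · refine (min_le_right _ _).trans ?_
    unfold excess
    rw [dist_insert, hxj]
    gcongr
    exact min_le_left _ _

lemma potential_le (g : K) (C : Finset ℕ) : A.potential g C ≤ A.n * g := by
  unfold potential
  refine (Finset.sum_le_card_nsmul _ _ g fun y _ => min_le_left _ _).trans ?_
  simp

/-- The greedy choice is at least as good as the average over `D`, so the distance of the potential
to the excess of `D` contracts by `1 - 1/|D|` per step, starting from at most `n g`. Denominators
are cleared. -/
lemma Greedy.potential_le {A : CostMatrix K} {U : ℕ} {g : K} {t : ℕ} {C : Finset ℕ}
    (h : A.Greedy U g t C) {D : Finset ℕ} (hDU : ∀ y ∈ D, y < U) (hD : D.Nonempty) :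
    (D.card : K) ^ t * (A.potential g C - ∑ j ∈ Finset.range A.n, A.excess D j) ≤
      (D.card - 1 : K) ^ t * (A.n * g - ∑ j ∈ Finset.range A.n, A.excess D j) := by
  have hk : (1 : K) ≤ D.card := by exact_mod_cast Finset.card_pos.2 hD
  induction h with
  | zero => simpa using A.potential_le g ∅
  | @step t C x _ hx ih =>
    have h1 : (D.card : K) * A.potential g (insert x C) ≤ (D.card - 1 : K) * A.potential g C +
        ∑ j ∈ Finset.range A.n, A.excess D j := by
      rw [← nsmul_eq_mul]
      exact (Finset.card_nsmul_le_sum D _ _ fun y hy => hx y (hDU y hy)).trans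
        (A.sum_potential_insert_le g C hD)
    set G := ∑ j ∈ Finset.range A.n, A.excess D j
    calc (D.card : K) ^ (t + 1) * (A.potential g (insert x C) - G)
        = (D.card : K) ^ t * (D.card * A.potential g (insert x C) - D.card * G) := by ring
      _ ≤ (D.card : K) ^ t * ((D.card - 1) * A.potential g C + G - D.card * G) := by gcongr
      _ = (D.card - 1) * ((D.card : K) ^ t * (A.potential g C - G)) := by ring
      _ ≤ (D.card - 1) * ((D.card - 1 : K) ^ t * (A.n * g - G)) :=
          mul_le_mul_of_nonneg_left ih (by linarith)
      _ = _ := by ring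

/-- Excesses only decrease, so a customer chosen as the current worst had initially at least the
excess that anyone has later. Once served its excess is zero, hence it is not chosen again while a
positive excess remains: the `r` choices are distinct unless everything has become zero. -/
lemma Fill.exists_selected {A : CostMatrix K} {C₀ C : Finset ℕ} {r : ℕ} (h : A.Fill C₀ r C) :
    (∀ i < A.n, A.excess C i ≤ A.excess C₀ i) ∧ ((∀ i < A.n, A.excess C i = 0) ∨
      ∃ J ⊆ Finset.range A.n, J.card = r ∧ ∀ j ∈ J, A.excess C j = 0 ∧
        ∀ i < A.n, A.excess C i ≤ A.excess C₀ j) := by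
  induction h with
  | zero => exact ⟨fun _ _ => le_rfl, Or.inr ⟨∅, by simp⟩⟩
  | @step r j C _ hj hmax ih =>
    obtain ⟨hle, ih⟩ := ih
    have hins := A.excess_insert_le (A.best j) C
    refine ⟨fun i hi => (hins i).trans (hle i hi), ?_⟩
    rcases (A.excess_nonneg C hj).eq_or_lt with h0 | hpos
    · left
      intro i hi
      exact le_antisymm ((hins i).trans (h0 ▸ hmax i hi)) (A.excess_nonneg _ hi)
    rcases ih with ih | ⟨J, hJ, hcard, hsel⟩
    · exact absurd (ih j hj) hpos.ne'
    right
    have hjJ : j ∉ J := fun hm => hpos.ne' (hsel j hm).1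
    refine ⟨insert j J, ?_, by rw [Finset.card_insert_of_notMem hjJ, hcard], ?_⟩
    · exact Finset.insert_subset (Finset.mem_range.2 hj) hJ
    · intro i hi
      rcases Finset.mem_insert.1 hi with rfl | hi
      · exact ⟨A.excess_insert_best C hj, fun l hl =>
          (hins l).trans ((hmax l hl).trans (hle i hj))⟩
      · refine ⟨le_antisymm ((hins i).trans (hsel i hi).1.le)
          (A.excess_nonneg _ (Finset.mem_range.1 (hJ hi))), fun l hl =>
          (hins l).trans ((hsel i hi).2 l hl)⟩

/-- A surviving excess above `g` would, together with the `r` served customers, give `r + 1`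
customers that each contributed the full cap `g` to the initial potential. -/
lemma Fill.excess_le {A : CostMatrix K} {C₀ C : Finset ℕ} {r : ℕ} (h : A.Fill C₀ r C) {g : K}
    (hg : 0 ≤ g) (hpot : A.potential g C₀ < (r + 1) * g) : ∀ i < A.n, A.excess C i ≤ g := by
  intro i hi
  by_contra! hgi
  obtain ⟨hle, h0 | ⟨J, hJ, hcard, hsel⟩⟩ := h.exists_selected
  · rw [h0 i hi] at hgi
    exact hgi.not_ge hg
  have hiJ : i ∉ J := fun hm => (hg.trans_lt hgi).ne' (hsel i hm).1
  refine hpot.not_ge ?_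
  have hsub : insert i J ⊆ Finset.range A.n := Finset.insert_subset (Finset.mem_range.2 hi) hJ
  calc (r + 1) * g = (insert i J).card • g := by
        rw [Finset.card_insert_of_notMem hiJ, hcard, nsmul_eq_mul]; push_cast; ring
    _ ≤ ∑ j ∈ insert i J, min g (A.excess C₀ j) := by
        refine Finset.card_nsmul_le_sum _ _ _ fun j hj => le_min le_rfl ?_
        rcases Finset.mem_insert.1 hj with rfl | hj
        · exact hgi.le.trans (hle j hi)
        · exact hgi.le.trans ((hsel j hj).2 i hi)
    _ ≤ A.potential g C₀ := Finset.sum_le_sum_of_subset_of_nonneg hsub fun j hj _ =>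
        le_min hg (A.excess_nonneg _ (Finset.mem_range.1 hj))

/-- Only the `n - r` unserved customers have excess left. Each of these excesses is at most the
capped initial excess of the same customer and of every served one. Weighting the first comparison
by `n - r` and the second by `r` bounds `n` times the remainder by `n - r` times the whole
potential. -/
lemma Fill.sum_excess_le {A : CostMatrix K} {C₀ C : Finset ℕ} {r : ℕ} (h : A.Fill C₀ r C) {g : K}
    (hg : 0 ≤ g) (hr : r ≤ A.n) (hC : ∀ i < A.n, A.excess C i ≤ g) :
    A.n * ∑ i ∈ Finset.range A.n, A.excess C i ≤ (A.n - r : K) * A.potential g C₀ := by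
  have hnr : (0 : K) ≤ A.n - r := sub_nonneg.2 (by exact_mod_cast hr)
  have hpot : 0 ≤ A.potential g C₀ := Finset.sum_nonneg fun j hj =>
        le_min hg (A.excess_nonneg _ (Finset.mem_range.1 hj))
  obtain ⟨hle, h0 | ⟨J, hJ, hcard, hsel⟩⟩ := h.exists_selected
  · rw [Finset.sum_eq_zero fun i hi => h0 i (Finset.mem_range.1 hi), mul_zero]
    exact mul_nonneg hnr hpot
  have hzero : ∑ i ∈ J, A.excess C i = 0 := Finset.sum_eq_zero fun i hi => (hsel i hi).1
  have hsplit := Finset.sum_sdiff (f := A.excess C) hJ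
  rw [hzero, add_zero] at hsplit
  have hsplit' := Finset.sum_sdiff (f := fun j => min g (A.excess C₀ j)) hJ
  have hcard' : ((Finset.range A.n \ J).card : K) = A.n - r := by
    rw [Finset.card_sdiff_of_subset hJ, hcard, Finset.card_range, Nat.cast_sub hr]
  have h1 : ∑ i ∈ Finset.range A.n \ J, A.excess C i ≤
      ∑ i ∈ Finset.range A.n \ J, min g (A.excess C₀ i) := by
    refine Finset.sum_le_sum fun i hi => ?_
    have hi := Finset.mem_range.1 (Finset.mem_sdiff.1 hi).1
    exact le_min (hC i hi) (hle i hi)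
  have h2 : ∀ j ∈ J, ∑ i ∈ Finset.range A.n \ J, A.excess C i ≤
      (A.n - r : K) * min g (A.excess C₀ j) := by
    intro j hj
    rw [← hcard', ← nsmul_eq_mul]
    refine Finset.sum_le_card_nsmul _ _ _ fun i hi => ?_
    have hi := Finset.mem_range.1 (Finset.mem_sdiff.1 hi).1
    exact le_min (hC i hi) ((hsel j hj).2 i hi)
  have h3 : (r : K) * ∑ i ∈ Finset.range A.n \ J, A.excess C i ≤
      (A.n - r : K) * ∑ j ∈ J, min g (A.excess C₀ j) := by
    rw [← nsmul_eq_mul, Finset.mul_sum]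
    simpa only [hcard] using Finset.card_nsmul_le_sum J _ _ h2
  have h4 := mul_le_mul_of_nonneg_left h1 hnr
  rw [← hsplit]
  unfold potential
  rw [← hsplit', mul_add]
  linarith

/-- If a `D` of size `k` has excess `G`, then a cap slightly above `G n / ((2k+1)(n-2k))`
is a good one. -/
lemma total_le_of_cap {A : CostMatrix K} {U t k : ℕ} {g : K} {C₀ C D : Finset ℕ}
    (hgr : A.Greedy U g t C₀) (hfill : A.Fill C₀ (2 * k) C) (hDU : ∀ y ∈ D, y < U)
    (hDk : D.card = k) (hk : 1 ≤ k) (hn : 2 * k < A.n)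
    (ht : (k - 1) ^ t * A.n ^ 2 ≤ k ^ t * (2 * k * (2 * k + 1)))
    (hg₁ : A.n * ∑ j ∈ Finset.range A.n, A.excess D j < g * ((2 * k + 1) * (A.n - 2 * k)))
    (hg₂ : (g - (∑ j ∈ Finset.range A.n, A.excess D j) / A.n) * ((2 * k + 1) * (A.n - 2 * k)) ≤
      A.n * ∑ j ∈ Finset.range A.n, A.excess D j) :
    A.total C ≤ A.total D := by
  have hD : D.Nonempty := Finset.card_pos.1 (by omega)
  have hpot := hgr.potential_le hDU hD
  rw [hDk] at hpot
  have hkK : (1 : K) ≤ k := by exact_mod_cast hk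
  have hnK : (2 * k + 1 : K) ≤ A.n := by exact_mod_cast hn
  have hn0 : (0 : K) < A.n := by linarith
  have hsum := A.sum_excess D
  have hsum' := A.sum_excess C
  have hG : 0 ≤ ∑ j ∈ Finset.range A.n, A.excess D j :=
    Finset.sum_nonneg fun j hj => A.excess_nonneg _ (Finset.mem_range.1 hj)
  set G := ∑ j ∈ Finset.range A.n, A.excess D j
  have ht' : ((k : K) - 1) ^ t * A.n ^ 2 ≤ k ^ t * (2 * k * (2 * k + 1)) := by
    have := (Nat.cast_le (α := K)).2 ht
    push_cast [Nat.cast_sub hk] at this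
    exact this
  have hpk : (0 : K) < k ^ t := pow_pos (by linarith) t
  have hpk1 : (0 : K) ≤ (k - 1) ^ t := pow_nonneg (by linarith) t
  have hw : (0 : K) < A.n - 2 * k := by linarith
  have h2k : (0 : K) < 2 * k + 1 := by linarith
  have hg0 : 0 < g := by
    by_contra! hg
    have := mul_nonneg hn0.le hG
    have h2 := mul_nonneg (neg_nonneg.2 hg) (mul_pos h2k hw).le
    linarith
  -- The upper end of the window for `g`, multiplied by `n`.
  have hcap : (A.n * g - G) * ((2 * k + 1) * (A.n - 2 * k)) ≤ A.n ^ 2 * G := by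
    have := mul_le_mul_of_nonneg_left hg₂ hn0.le
    have e : A.n * ((g - G / A.n) * ((2 * k + 1) * (A.n - 2 * k))) =
      (A.n * g - G) * ((2 * k + 1) * (A.n - 2 * k : K)) := by field_simp
    rw [e] at this
    calc _ ≤ _ := this
      _ = _ := by ring
  -- Exactly what makes the factor `(n - 2k)/n` of the filling phase bring the excess down to `G`.
  -- The contraction, `hcap` and the choice of `t` give `(n - 2k)(potential - G) ≤ 2k G`.
  have hcond : (A.n - 2 * k) * A.potential g C₀ ≤ A.n * G := by
    have key : (k : K) ^ t * (2 * k + 1) * ((A.n - 2 * k) * (A.potential g C₀ - G)) ≤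
        k ^ t * (2 * k + 1) * (2 * k * G) := by
      calc (k : K) ^ t * (2 * k + 1) * ((A.n - 2 * k) * (A.potential g C₀ - G))
          = (2 * k + 1) * (A.n - 2 * k) * (k ^ t * (A.potential g C₀ - G)) := by ring
        _ ≤ (2 * k + 1) * (A.n - 2 * k) * ((k - 1) ^ t * (A.n * g - G)) :=
            mul_le_mul_of_nonneg_left hpot (mul_pos h2k hw).le
        _ = (k - 1) ^ t * ((A.n * g - G) * ((2 * k + 1) * (A.n - 2 * k))) := by ring
        _ ≤ (k - 1) ^ t * (A.n ^ 2 * G) := mul_le_mul_of_nonneg_left hcap hpk1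
        _ = (k - 1) ^ t * A.n ^ 2 * G := by ring
        _ ≤ k ^ t * (2 * k * (2 * k + 1)) * G := mul_le_mul_of_nonneg_right ht' hG
        _ = _ := by ring
    have := le_of_mul_le_mul_left key (mul_pos hpk h2k)
    linarith
  -- The strict lower end of the window: the potential is at most `n G / (n - 2k) < (2k+1) g`.
  have hlt : A.potential g C₀ < ((2 * k : ℕ) + 1) * g := by
    push_cast
    by_contra! hge
    have := mul_le_mul_of_nonneg_left hge hw.le
    linarith
  have hC := hfill.excess_le hg0.le hlt
  have hfin := hfill.sum_excess_le hg0.le hn.le hC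
  push_cast at hfin
  have hle := le_of_mul_le_mul_left (hfin.trans hcond) hn0
  rw [hsum', hsum] at hle
  linarith [le_of_mul_le_mul_left hle hn0]

/-- If some `D` of size `k` has no excess, then a cap below all positive excesses is good. -/
lemma total_le_of_small_cap {A : CostMatrix K} {U t k : ℕ} {g : K} {C₀ C D : Finset ℕ}
    (hgr : A.Greedy U g t C₀) (hfill : A.Fill C₀ (2 * k) C) (hDU : ∀ y ∈ D, y < U)
    (hDk : D.card = k) (hk : 1 ≤ k) (hn : 2 * k < A.n)
    (ht : (k - 1) ^ t * A.n ^ 2 ≤ k ^ t * (2 * k * (2 * k + 1)))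
    (hD0 : ∑ j ∈ Finset.range A.n, A.excess D j = 0) (hg : 0 < g)
    (hsmall : ∀ j < A.n, A.excess C j ≤ g → A.excess C j = 0) :
    A.total C ≤ A.total D := by
  have hD : D.Nonempty := Finset.card_pos.1 (by omega)
  have hpot := hgr.potential_le hDU hD
  rw [hDk, hD0] at hpot
  have hkK : (1 : K) ≤ k := by exact_mod_cast hk
  have hnK : (2 * k + 1 : K) ≤ A.n := by exact_mod_cast hn
  have hn0 : (0 : K) < A.n := by linarith
  have hsum := A.sum_excess D
  have hsum' := A.sum_excess C
  have ht' : ((k : K) - 1) ^ t * A.n ^ 2 ≤ k ^ t * (2 * k * (2 * k + 1)) := by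
    have := (Nat.cast_le (α := K)).2 ht
    push_cast [Nat.cast_sub hk] at this
    exact this
  have hpk : (0 : K) < k ^ t := pow_pos (by linarith) t
  -- With `G = 0` the potential is at most `(1-1/k)^t n g ≤ 2k(2k+1) g / n`, and `2k < n`.
  have hlt : A.potential g C₀ < ((2 * k : ℕ) + 1) * g := by
    push_cast
    have h1 : (k : K) ^ t * A.n * A.potential g C₀ ≤ k ^ t * (2 * k * (2 * k + 1)) * g := by
      calc (k : K) ^ t * A.n * A.potential g C₀ = A.n * (k ^ t * (A.potential g C₀ - 0)) := by ring
        _ ≤ A.n * ((k - 1) ^ t * (A.n * g - 0)) := mul_le_mul_of_nonneg_left hpot hn0.le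
        _ = (k - 1) ^ t * A.n ^ 2 * g := by ring
        _ ≤ _ := mul_le_mul_of_nonneg_right ht' hg.le
    have h2 : (k : K) ^ t * (2 * k * (2 * k + 1)) * g < k ^ t * A.n * ((2 * k + 1) * g) := by
      have : (0 : K) < k ^ t * (2 * k + 1) * g * (A.n - 2 * k) :=
        mul_pos (mul_pos (mul_pos hpk (by linarith)) hg) (by linarith)
      linarith
    exact lt_of_mul_lt_mul_left (h1.trans_lt h2) (mul_pos hpk hn0).le
  have hC := hfill.excess_le hg.le hlt
  rw [Finset.sum_eq_zero fun j hj => hsmall j (Finset.mem_range.1 hj)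
    (hC j (Finset.mem_range.1 hj))] at hsum'
  rw [hD0] at hsum
  exact (sub_left_inj.1 (mul_left_cancel₀ hn0.ne' (hsum'.symm.trans hsum))).le

/-- If every customer gets its own round, then the total cost is least possible. -/
lemma Fill.total_le {A : CostMatrix K} {C₀ C : Finset ℕ} (h : A.Fill C₀ A.n C) (D : Finset ℕ) :
    A.total C ≤ A.total D := by
  rcases Nat.eq_zero_or_pos A.n with hn | hn
  · simp [total, hn]
  have hn' : (0 : K) < A.n := by exact_mod_cast hn
  have h0 : ∀ i < A.n, A.excess C i = 0 := by
    obtain ⟨-, h0 | ⟨J, hJ, hcard, hsel⟩⟩ := h.exists_selected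
    · exact h0
    · have : J = Finset.range A.n := Finset.eq_of_subset_of_card_le hJ (by simp [hcard])
      exact fun i hi => (hsel i (this ▸ Finset.mem_range.2 hi)).1
  refine Finset.sum_le_sum fun j hj => ?_
  have hj := Finset.mem_range.1 hj
  have := (mul_eq_zero.1 (h0 j hj)).resolve_left hn'.ne'
  rw [sub_eq_zero.1 this]
  exact A.low_le_dist D hj

/-- One of the caps `r v`, where `v` is a difference of costs or `1` and `1 ≤ r ≤ (n + 1)²`,
leads to a total cost that is at most the cost of a given set of `k` centers. -/
theorem exists_good_cap (A : CostMatrix K) {U t k m : ℕ} {val : ℕ → K} {D : Finset ℕ}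
    (hval : ∀ x, ∀ j < A.n, A.c x j < A.Z → ∃ e < m, val e = A.c x j - A.low j)
    (hvalm : val m = 1) (hZ : ∀ x, ∀ j < A.n, A.c x j < A.Z → A.c x j + 1 ≤ A.Z)
    (hDU : ∀ y ∈ D, y < U) (hDk : D.card = k) (hk : 1 ≤ k)
    (hfeas : ∀ j < A.n, A.dist D j < A.Z)
    (ht : (k - 1) ^ t * A.n ^ 2 ≤ k ^ t * (2 * k * (2 * k + 1))) :
    ∃ e ≤ m, ∃ r, 1 ≤ r ∧ r ≤ (A.n + 1) * (A.n + 1) ∧ ∀ C₀ C,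
      A.Greedy U (r * val e) t C₀ → A.Fill C₀ (A.n - (A.n - 2 * k)) C →
        A.total C ≤ A.total D := by
  have hD : D.Nonempty := Finset.card_pos.1 (by omega)
  rcases le_or_gt A.n (2 * k) with hn | hn
  · refine ⟨m, le_rfl, 1, le_rfl, by nlinarith, fun C₀ C _ hf => ?_⟩
    rw [show A.n - (A.n - 2 * k) = A.n by omega] at hf
    exact hf.total_le D
  rw [show A.n - (A.n - 2 * k) = 2 * k by omega]
  have hkK : (1 : K) ≤ k := by exact_mod_cast hk
  have hnK : (2 * k + 1 : K) ≤ A.n := by exact_mod_cast hn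
  have hn0 : (0 : K) < A.n := by linarith
  have hG : 0 ≤ ∑ j ∈ Finset.range A.n, A.excess D j :=
    Finset.sum_nonneg fun j hj => A.excess_nonneg _ (Finset.mem_range.1 hj)
  have hdval : ∀ j < A.n, ∀ C, A.dist C j < A.Z → ∃ e < m, val e = A.dist C j - A.low j := by
    intro j hj C hlt
    rcases A.dist_eq_Z_or C j with h | ⟨x, -, h⟩
    · exact absurd h hlt.ne
    · rw [h] at hlt ⊢
      exact hval x j hj hlt
  rcases hG.eq_or_lt with hG0 | hGpos
  · -- the cap is the least positive value
    obtain ⟨e, he, hemin⟩ := Finset.exists_min_image ((Finset.range (m + 1)).filter (0 < val ·)) val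
      ⟨m, by simp [hvalm]⟩
    simp only [Finset.mem_filter, Finset.mem_range] at he hemin
    refine ⟨e, by omega, 1, le_rfl, by nlinarith, fun C₀ C hgr hf => ?_⟩
    rw [Nat.cast_one, one_mul] at hgr
    refine total_le_of_small_cap hgr hf hDU hDk hk hn ht hG0.symm he.2 fun j hj hle => ?_
    by_contra hne
    have hpos := lt_of_le_of_ne (A.excess_nonneg C hj) (Ne.symm hne)
    have hdpos : 0 < A.dist C j - A.low j := pos_of_mul_pos_right hpos hn0.le
    have hv : val e ≤ A.dist C j - A.low j := by
      rcases (A.dist_le_Z C j).lt_or_eq with hlt | heq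
      · obtain ⟨e', he', hv⟩ := hdval j hj C hlt
        rw [← hv]
        exact hemin e' ⟨by omega, by rw [hv]; exact hdpos⟩
      -- An unserved customer pays `Z`, at least `1` above its least cost; the extra value `1` in
      -- the list keeps the cap below this gap and also ensures that a positive value exists.
      · have h1 := hemin m ⟨by omega, by simp [hvalm]⟩
        have h2 := hZ (A.best j) j hj (by
          rw [A.c_best j hj]
          exact (A.low_le_dist D hj).trans_lt (hfeas j hj))
        rw [A.c_best j hj] at h2
        rw [heq]
        linarith
    -- The scaling by `n > 1` makes every positive excess strictly larger than the cap `val e`.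
    have : (A.n : K) * val e ≤ A.excess C j := mul_le_mul_of_nonneg_left hv hn0.le
    have h3 : 0 < ((A.n : K) - 1) * val e := mul_pos (by linarith) he.2
    linarith
  -- The unit of the cap is the largest deviation under `D`: small enough to be a step inside the
  -- window, large enough that few steps reach it.
  · obtain ⟨j, hj, hjmax⟩ := Finset.exists_max_image (Finset.range A.n)
      (fun j => A.dist D j - A.low j) ⟨0, by simp; omega⟩
    have hj' := Finset.mem_range.1 hj
    obtain ⟨e, he, hv⟩ := hdval j hj' D (hfeas j hj')
    rw [← hv] at hjmax
    set G := ∑ j ∈ Finset.range A.n, A.excess D j with hGdef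
    have hGle : G ≤ A.n * (A.n * val e) := by
      calc G ≤ (Finset.range A.n).card • (A.n * val e) :=
            Finset.sum_le_card_nsmul _ _ _ fun i hi =>
              mul_le_mul_of_nonneg_left (hjmax i hi) hn0.le
        _ = _ := by simp
    have hleG : A.n * val e ≤ G := by
      rw [hv]
      exact Finset.single_le_sum (f := A.excess D)
        (fun i hi => A.excess_nonneg _ (Finset.mem_range.1 hi)) hj
    have hvpos : 0 < val e := by
      by_contra! hle
      have := mul_nonneg hn0.le (mul_nonneg hn0.le (neg_nonneg.2 hle))
      linarith
    set w : ℕ := (2 * k + 1) * (A.n - 2 * k) with hw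
    have hwK : (w : K) = (2 * k + 1) * (A.n - 2 * k) := by
      rw [hw]; push_cast [Nat.cast_sub hn.le]; ring
    have hwn : A.n ≤ w := by
      obtain ⟨d, hd⟩ : ∃ d, A.n = 2 * k + 1 + d := ⟨A.n - (2 * k + 1), by omega⟩
      rw [hw, hd, show 2 * k + 1 + d - 2 * k = d + 1 by omega]
      nlinarith
    have hw0 : (0 : K) < w := by
      have : 0 < w := by omega
      exact_mod_cast this
    -- The least multiple beyond `n G / w`. It is at most `n² + 1`, as `G ≤ n² val e` and `n ≤ w`;
    -- by minimality it overshoots by at most `val e ≤ G / n`.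
    have hex : ∃ r : ℕ, A.n * G < r * val e * w := by
      refine ⟨A.n * A.n + 1, ?_⟩
      have h1 : A.n * G ≤ A.n * (A.n * (A.n * val e)) := mul_le_mul_of_nonneg_left hGle hn0.le
      have h2 : A.n * (A.n * val e) * A.n ≤ A.n * (A.n * val e) * w :=
        mul_le_mul_of_nonneg_left (by exact_mod_cast hwn)
          (mul_nonneg hn0.le (mul_nonneg hn0.le hvpos.le))
      have h3 := mul_pos hvpos hw0
      push_cast
      linarith
    classical
    have hspec := Nat.find_spec hex
    have hr : Nat.find hex ≤ A.n * A.n + 1 := by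
      refine Nat.find_min' hex ?_
      have h1 : A.n * G ≤ A.n * (A.n * (A.n * val e)) := mul_le_mul_of_nonneg_left hGle hn0.le
      have h2 : A.n * (A.n * val e) * A.n ≤ A.n * (A.n * val e) * w :=
        mul_le_mul_of_nonneg_left (by exact_mod_cast hwn)
          (mul_nonneg hn0.le (mul_nonneg hn0.le hvpos.le))
      have h3 := mul_pos hvpos hw0
      push_cast
      linarith
    have hr1 : 1 ≤ Nat.find hex := by
      by_contra! h0
      rw [show Nat.find hex = 0 by omega] at hspec
      have := mul_pos hn0 hGpos
      simp at hspec
      linarith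
    have hprev := Nat.find_min hex (m := Nat.find hex - 1) (by omega)
    refine ⟨e, he.le, Nat.find hex, hr1, by nlinarith, fun C₀ C hgr hf => ?_⟩
    refine total_le_of_cap hgr hf hDU hDk hk hn ht ?_ ?_
    · rw [← hwK]; exact hspec
    · rw [← hwK, ← hGdef]
      rw [not_lt] at hprev
      push_cast [Nat.cast_sub hr1] at hprev
      refine le_trans ?_ hprev
      refine mul_le_mul_of_nonneg_right ?_ hw0.le
      have : val e ≤ G / A.n := by rw [le_div_iff₀ hn0]; linarith
      linarith

end CostMatrix

/-! ### Transfer from unit cost to logarithmic cost -/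

namespace FieldRAM

/-- The number of operations in an expression. -/
def NatExpr.ops : NatExpr → ℕ
  | .lit _ => 1
  | .get _ i => i.ops + 1
  | .add x y => x.ops + y.ops + 1
  | .sub x y => x.ops + y.ops + 1

/-- The number of operations in an expression. -/
def FldExpr.ops : FldExpr → ℕ
  | .ofNat x => x.ops + 1
  | .get _ i => i.ops + 1
  | .add x y => x.ops + y.ops + 1
  | .sub x y => x.ops + y.ops + 1
  | .mul x y => x.ops + y.ops + 1
  | .div x y => x.ops + y.ops + 1

/-- The number of operations in a test. -/
def Test.ops : Test → ℕ
  | .natLe x y => x.ops + y.ops + 1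
  | .fldLe x y => x.ops + y.ops + 1

lemma NatExpr.price_unit {K : Type} (s : State K) (e : NatExpr) :
    e.price (unitPricing K) s = e.ops := by
  induction e <;> simp_all only [NatExpr.price, NatExpr.ops, unitPricing]

lemma FldExpr.price_unit {K : Type} [Field K] (s : State K) (e : FldExpr) :
    e.price (unitPricing K) s = e.ops := by
  induction e <;> simp only [FldExpr.price, FldExpr.ops, NatExpr.price_unit] <;>
    simp_all only [unitPricing]

lemma Test.price_unit {K : Type} [Field K] (s : State K) (b : Test) :
    b.price (unitPricing K) s = b.ops := by
  cases b <;> simp only [Test.price, Test.ops, NatExpr.price_unit, FldExpr.price_unit]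

/-- All literals in the expression are at most `c`. -/
def NatExpr.LitLe (c : ℕ) : NatExpr → Prop
  | .lit d => d ≤ c
  | .get _ i => i.LitLe c
  | .add x y => x.LitLe c ∧ y.LitLe c
  | .sub x y => x.LitLe c ∧ y.LitLe c

/-- The expression has no division, its products have a natural number as first factor, and all
its literals are at most `c`. -/
def FldExpr.Linear (c : ℕ) : FldExpr → Prop
  | .ofNat x => x.LitLe c
  | .get _ i => i.LitLe c
  | .add x y => x.Linear c ∧ y.Linear c
  | .sub x y => x.Linear c ∧ y.Linear c
  | .mul (.ofNat x) y => x.LitLe c ∧ y.Linear c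
  | .mul _ _ => False
  | .div _ _ => False

/-- Both sides of the comparison are linear expressions. -/
def Test.Linear (c : ℕ) : Test → Prop
  | .natLe x y => x.LitLe c ∧ y.LitLe c
  | .fldLe x y => x.Linear c ∧ y.Linear c

/-- All field expressions in the program are linear, and all literals are at most `c`. -/
def Prog.Linear (c : ℕ) : Prog → Prop
  | .skip => True
  | .setNat _ i e => i.LitLe c ∧ e.LitLe c
  | .setFld _ i e => i.LitLe c ∧ e.Linear c
  | .seq p q => p.Linear c ∧ q.Linear c
  | .ite b p q => b.Linear c ∧ p.Linear c ∧ q.Linear c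
  | .loop b p => b.Linear c ∧ p.Linear c

/-- `q` is an integer multiple of `1 / d` of absolute value at most `2 ^ h / d`. -/
def IsMultiple (d h : ℕ) (q : ℚ) : Prop := ∃ z : ℤ, q = z / d ∧ |z| ≤ 2 ^ h

lemma IsMultiple.mono {d h h' : ℕ} {q : ℚ} (hq : IsMultiple d h q) (hh : h ≤ h') :
    IsMultiple d h' q := by
  obtain ⟨z, hz, hz'⟩ := hq
  exact ⟨z, hz, hz'.trans (pow_le_pow_right₀ (by norm_num) hh)⟩

lemma IsMultiple.add {d h : ℕ} {q q' : ℚ} (hq : IsMultiple d h q) (hq' : IsMultiple d h q') :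
    IsMultiple d (h + 1) (q + q') := by
  obtain ⟨z, rfl, hz⟩ := hq
  obtain ⟨w, rfl, hw⟩ := hq'
  refine ⟨z + w, by push_cast; ring, (abs_add_le z w).trans ?_⟩
  rw [pow_succ]
  linarith

lemma IsMultiple.neg {d h : ℕ} {q : ℚ} (hq : IsMultiple d h q) : IsMultiple d h (-q) := by
  obtain ⟨z, rfl, hz⟩ := hq
  exact ⟨-z, by push_cast; ring, by rwa [abs_neg]⟩

lemma IsMultiple.sub {d h : ℕ} {q q' : ℚ} (hq : IsMultiple d h q) (hq' : IsMultiple d h q') :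
    IsMultiple d (h + 1) (q - q') := by
  rw [sub_eq_add_neg]
  exact hq.add hq'.neg

lemma IsMultiple.natCast_mul {d h w x : ℕ} {q : ℚ} (hq : IsMultiple d h q) (hx : x ≤ 2 ^ w) :
    IsMultiple d (w + h) (x * q) := by
  obtain ⟨z, rfl, hz⟩ := hq
  refine ⟨x * z, by push_cast; ring, ?_⟩
  rw [abs_mul, pow_add, Nat.abs_cast]
  exact mul_le_mul (by exact_mod_cast hx) hz (abs_nonneg _) (by positivity)

lemma IsMultiple.one {d h : ℕ} (hd : 0 < d) (hdh : d ≤ 2 ^ h) : IsMultiple d h 1 := by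
  refine ⟨d, ?_, by rw [Nat.abs_cast]; exact_mod_cast hdh⟩
  have : (d : ℚ) ≠ 0 := by exact_mod_cast hd.ne'
  rw [Int.cast_natCast, div_self this]

lemma IsMultiple.natCast {d h w x : ℕ} (hd : 0 < d) (hdh : d ≤ 2 ^ h) (hx : x ≤ 2 ^ w) :
    IsMultiple d (w + h) (x : ℚ) := by
  simpa using (IsMultiple.one hd hdh).natCast_mul hx

/-- Reduction to lowest terms only replaces the numerator and the denominator by divisors. -/
lemma IsMultiple.ratBits_le {d h : ℕ} {q : ℚ} (hd : 0 < d) (hdh : d ≤ 2 ^ h)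
    (hq : IsMultiple d h q) : ratBits q ≤ 2 * h + 2 := by
  obtain ⟨z, rfl, hz⟩ := hq
  have hlt : ∀ x : ℕ, x ≤ 2 ^ h → Nat.size x ≤ h + 1 := fun x hx =>
    Nat.size_le.2 (hx.trans_lt (Nat.pow_lt_pow_right (by norm_num) (Nat.lt_succ_self h)))
  have hd' : (d : ℤ) ≠ 0 := by exact_mod_cast hd.ne'
  have hden : ((z : ℚ) / d).den ≤ d := by
    have := Rat.den_dvd z d
    rw [Rat.divInt_eq_div, Int.cast_natCast] at this
    exact Nat.le_of_dvd hd (by exact_mod_cast this)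
  have hnum : ((z : ℚ) / d).num.natAbs ≤ 2 ^ h := by
    have h1 : (((z : ℚ) / d).num.natAbs : ℤ) ≤ |z| := by
      rcases eq_or_ne z 0 with rfl | hz0
      · simp
      · have := Rat.num_dvd z hd'
        rw [Rat.divInt_eq_div, Int.cast_natCast] at this
        rw [← Int.abs_eq_natAbs]
        exact Int.le_of_dvd (abs_pos.2 hz0) ((abs_dvd_abs _ _).2 this)
    exact_mod_cast h1.trans hz
  unfold ratBits
  have := hlt _ hnum
  have := hlt _ (hden.trans hdh)
  omega

lemma size_add_one_le {x w : ℕ} (hx : x ≤ 2 ^ w) : Nat.size x + 1 ≤ w + 2 := by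
  have := Nat.size_le.2 (hx.trans_lt (Nat.pow_lt_pow_right (by norm_num) (Nat.lt_succ_self w)))
  omega

/-- Bounds for all numbers in the memory. -/
structure State.Bounded (d N H : ℕ) (s : State ℚ) : Prop where
  nat_le : ∀ a i, s.nat a i ≤ 2 ^ N
  fld_isMultiple : ∀ a i, IsMultiple d H (s.fld a i)

lemma State.Bounded.mono {d N H N' H' : ℕ} {s : State ℚ} (hs : s.Bounded d N H) (hN : N ≤ N')
    (hH : H ≤ H') : s.Bounded d N' H' :=
  ⟨fun a i => (hs.nat_le a i).trans (Nat.pow_le_pow_right (by norm_num) hN),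
    fun a i => (hs.fld_isMultiple a i).mono hH⟩

/-- Naturals are only added and subtracted, so one operation adds at most one bit. -/
lemma State.Bounded.eval_nat {d N H c : ℕ} {s : State ℚ} (hs : s.Bounded d N H) (hc : c ≤ 2 ^ N) :
    ∀ e : NatExpr, e.LitLe c → e.eval s ≤ 2 ^ (N + e.ops)
  | .lit x, he => (le_trans he hc).trans (Nat.pow_le_pow_right (by norm_num) (by omega))
  | .get a i, _ => (hs.nat_le _ _).trans (Nat.pow_le_pow_right (by norm_num) (by omega))
  | .add x y, he => by
    have h1 := (hs.eval_nat hc x he.1).trans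
      (Nat.pow_le_pow_right (by norm_num) (show N + x.ops ≤ N + x.ops + y.ops by omega))
    have h2 := (hs.eval_nat hc y he.2).trans
      (Nat.pow_le_pow_right (by norm_num) (show N + y.ops ≤ N + x.ops + y.ops by omega))
    simp only [NatExpr.eval, NatExpr.ops, ← add_assoc]
    rw [pow_succ]
    omega
  | .sub x y, he => by
    have h1 := (hs.eval_nat hc x he.1).trans
      (Nat.pow_le_pow_right (by norm_num) (show N + x.ops ≤ N + (x.ops + y.ops + 1) by omega))
    simp only [NatExpr.eval, NatExpr.ops]
    omega

lemma State.Bounded.price_nat {d N H c W : ℕ} {s : State ℚ} (hs : s.Bounded d N H)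
    (hc : c ≤ 2 ^ N) : ∀ e : NatExpr, e.LitLe c → N + e.ops ≤ W →
      e.price bitPricing s ≤ (W + 2) * e.ops := by
  intro e he hW
  have hval := fun e he => hs.eval_nat hc e he
  have hmono : ∀ {x w : ℕ}, x ≤ 2 ^ w → w ≤ W → Nat.size x + 1 ≤ W + 2 :=
    fun hx hw => (size_add_one_le hx).trans (by omega)
  have hthis := hmono (hval e he) hW
  induction e with
  | lit x => simpa only [NatExpr.price, NatExpr.ops, NatExpr.eval, bitPricing, mul_one] using hthis
  | get a i ih =>
    simp only [NatExpr.ops] at hW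
    have := ih he (by omega) (hmono (hval i he) (by omega))
    simp only [NatExpr.price, NatExpr.ops, bitPricing, NatExpr.eval] at hthis ⊢
    simp only [bitPricing] at this
    rw [mul_add]
    omega
  | add x y ihx ihy =>
    simp only [NatExpr.ops] at hW
    have h1 := ihx he.1 (by omega) (hmono (hval x he.1) (by omega))
    have h2 := ihy he.2 (by omega) (hmono (hval y he.2) (by omega))
    simp only [NatExpr.price, NatExpr.ops, bitPricing, NatExpr.eval] at hthis h1 h2 ⊢
    rw [mul_add, mul_add]
    omega
  | sub x y ihx ihy =>
    simp only [NatExpr.ops] at hW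
    have h1 := ihx he.1 (by omega) (hmono (hval x he.1) (by omega))
    have h2 := ihy he.2 (by omega) (hmono (hval y he.2) (by omega))
    simp only [NatExpr.price, NatExpr.ops, bitPricing, NatExpr.eval] at hthis h1 h2 ⊢
    rw [mul_add, mul_add]
    omega

/-- The denominator `d` never changes. A sum adds one bit to the numerator, and a product with a
natural number below `2 ^ W` adds at most `W`; general products would double the length instead. -/
lemma State.Bounded.eval_fld {d N H c W : ℕ} {s : State ℚ} (hs : s.Bounded d N H)
    (hc : c ≤ 2 ^ N) (hd : 0 < d) (hdH : d ≤ 2 ^ H) : ∀ e : FldExpr, e.Linear c → N + e.ops ≤ W →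
      IsMultiple d (H + e.ops * (W + 1)) (e.eval s)
  | .ofNat x, he, hW => by
    simp only [FldExpr.ops] at hW ⊢
    refine (IsMultiple.natCast hd hdH (hs.eval_nat hc x he)).mono ?_
    nlinarith
  | .get a i, _, _ => (hs.fld_isMultiple _ _).mono (by omega)
  | .add x y, he, hW => by
    simp only [FldExpr.ops] at hW ⊢
    refine ((hs.eval_fld hc hd hdH x he.1 (W := W) (by omega)).mono ?_).add
      ((hs.eval_fld hc hd hdH y he.2 (W := W) (by omega)).mono ?_) |>.mono
        (h := H + (x.ops * (W + 1) + y.ops * (W + 1)) + 1) ?_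
    · omega
    · omega
    · rw [add_mul, add_mul]; omega
  | .sub x y, he, hW => by
    simp only [FldExpr.ops] at hW ⊢
    refine ((hs.eval_fld hc hd hdH x he.1 (W := W) (by omega)).mono ?_).sub
      ((hs.eval_fld hc hd hdH y he.2 (W := W) (by omega)).mono ?_) |>.mono
        (h := H + (x.ops * (W + 1) + y.ops * (W + 1)) + 1) ?_
    · omega
    · omega
    · rw [add_mul, add_mul]; omega
  | .mul (.ofNat x) y, he, hW => by
    simp only [FldExpr.ops] at hW ⊢
    refine ((hs.eval_fld hc hd hdH y he.2 (W := W) (by omega)).natCast_mul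
      (hs.eval_nat hc x he.1)).mono ?_
    nlinarith

lemma State.Bounded.price_fld {d N H c W B : ℕ} {s : State ℚ} (hs : s.Bounded d N H)
    (hc : c ≤ 2 ^ N) (hd : 0 < d) (hdH : d ≤ 2 ^ H) : ∀ e : FldExpr, e.Linear c → N + e.ops ≤ W →
      H + e.ops * (W + 1) ≤ B → e.price bitPricing s ≤ (2 * B + W + 3) * e.ops := by
  intro e he hW hB
  have hbits : ∀ e : FldExpr, e.Linear c → N + e.ops ≤ W → H + e.ops * (W + 1) ≤ B →
      ratBits (e.eval s) + 1 ≤ 2 * B + W + 3 := by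
    intro e he hW hB
    have h := ((hs.eval_fld hc hd hdH e he hW).mono hB).ratBits_le hd
      (hdH.trans (Nat.pow_le_pow_right (by norm_num) (by omega)))
    omega
  have hnat : ∀ e : NatExpr, e.LitLe c → N + e.ops ≤ W →
      e.price bitPricing s ≤ (2 * B + W + 3) * e.ops := fun e he hW =>
    (hs.price_nat hc e he hW).trans (Nat.mul_le_mul_right _ (by omega))
  have hthis := hbits e he hW hB
  induction e with
  | ofNat x =>
    simp only [FldExpr.ops] at hW
    have h1 := hnat x he (by omega)
    simp only [FldExpr.price, FldExpr.ops, bitPricing, FldExpr.eval] at hthis h1 ⊢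
    rw [mul_add]
    omega
  | get a i =>
    simp only [FldExpr.ops] at hW
    have h1 := hnat i he (by omega)
    simp only [FldExpr.price, FldExpr.ops, bitPricing, FldExpr.eval] at hthis h1 ⊢
    rw [mul_add]
    omega
  | add x y ihx ihy =>
    simp only [FldExpr.ops, add_mul] at hW hB
    have h1 := ihx he.1 (by omega) (by omega) (hbits x he.1 (by omega) (by omega))
    have h2 := ihy he.2 (by omega) (by omega) (hbits y he.2 (by omega) (by omega))
    simp only [FldExpr.price, FldExpr.ops, bitPricing, FldExpr.eval] at hthis h1 h2 ⊢
    rw [mul_add, mul_add]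
    omega
  | sub x y ihx ihy =>
    simp only [FldExpr.ops, add_mul] at hW hB
    have h1 := ihx he.1 (by omega) (by omega) (hbits x he.1 (by omega) (by omega))
    have h2 := ihy he.2 (by omega) (by omega) (hbits y he.2 (by omega) (by omega))
    simp only [FldExpr.price, FldExpr.ops, bitPricing, FldExpr.eval] at hthis h1 h2 ⊢
    rw [mul_add, mul_add]
    omega
  | mul x y ihx ihy =>
    simp only [FldExpr.ops, add_mul] at hW hB
    have he' : x.Linear c ∧ y.Linear c := by
      cases x with
      | ofNat x => exact he
      | _ => exact he.elim
    have h1 := ihx he'.1 (by omega) (by omega) (hbits x he'.1 (by omega) (by omega))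
    have h2 := ihy he'.2 (by omega) (by omega) (hbits y he'.2 (by omega) (by omega))
    simp only [FldExpr.price, FldExpr.ops, bitPricing, FldExpr.eval] at hthis h1 h2 ⊢
    rw [mul_add, mul_add]
    omega
  | div x y => exact he.elim

lemma State.Bounded.price_test {d N H c W B : ℕ} {s : State ℚ} (hs : s.Bounded d N H)
    (hc : c ≤ 2 ^ N) (hd : 0 < d) (hdH : d ≤ 2 ^ H) (b : Test) (hb : b.Linear c)
    (hW : N + b.ops ≤ W) (hB : H + b.ops * (W + 1) ≤ B) :
    b.price bitPricing s ≤ (2 * B + W + 3) * b.ops := by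
  cases b with
  | natLe x y =>
    simp only [Test.ops, add_mul] at hW hB
    have h1 := (hs.price_nat hc x hb.1 (W := W) (by omega)).trans
      (Nat.mul_le_mul_right _ (show W + 2 ≤ 2 * B + W + 3 by omega))
    have h2 := (hs.price_nat hc y hb.2 (W := W) (by omega)).trans
      (Nat.mul_le_mul_right _ (show W + 2 ≤ 2 * B + W + 3 by omega))
    simp only [Test.price, Test.ops]
    rw [mul_add, mul_add]
    omega
  | fldLe x y =>
    simp only [Test.ops, add_mul] at hW hB
    have h1 := hs.price_fld hc hd hdH x hb.1 (W := W) (B := B) (by omega) (by omega)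
    have h2 := hs.price_fld hc hd hdH y hb.2 (W := W) (B := B) (by omega) (by omega)
    simp only [Test.price, Test.ops]
    rw [mul_add, mul_add]
    omega

/-- A linear program that takes `t` operations takes time at most `t` times the number of bits
of the largest numbers that can arise. -/
theorem Run.exists_bit_run {p : Prog} {s s' : State ℚ} {t : ℕ} (h : Run (unitPricing ℚ) p s t s')
    {c d W B : ℕ} (hp : p.Linear c) (hd : 0 < d) : ∀ {N H : ℕ}, s.Bounded d N H → c ≤ 2 ^ N →
      d ≤ 2 ^ H → N + t ≤ W → H + t * (W + 1) ≤ B → s'.Bounded d (N + t) (H + t * (W + 1)) ∧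
        ∃ t' ≤ (2 * B + W + 3) * t, Run bitPricing p s t' s' := by
  have hpow : ∀ {x N N' : ℕ}, x ≤ 2 ^ N → N ≤ N' → x ≤ 2 ^ N' := fun hx hN =>
    hx.trans (Nat.pow_le_pow_right (by norm_num) hN)
  induction h with
  | skip s =>
    intro N H hs _ _ _ _
    exact ⟨hs.mono (by omega) (by omega), 1, by omega, .skip s⟩
  | setNat a i e s =>
    intro N H hs hc hdH hW hB
    simp only [NatExpr.price_unit] at hW hB ⊢
    simp only [add_mul] at hB
    have h1 := (hs.price_nat hc i hp.1 (W := W) (by omega)).trans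
      (Nat.mul_le_mul_right _ (show W + 2 ≤ 2 * B + W + 3 by omega))
    have h2 := (hs.price_nat hc e hp.2 (W := W) (by omega)).trans
      (Nat.mul_le_mul_right _ (show W + 2 ≤ 2 * B + W + 3 by omega))
    refine ⟨⟨fun a' i' => ?_, fun a' i' => (hs.fld_isMultiple a' i').mono (by omega)⟩, _, ?_,
      .setNat a i e s⟩
    · have h3 := hpow (hs.eval_nat hc e hp.2) (show N + e.ops ≤ N + (i.ops + e.ops + 1) by omega)
      have h4 := hpow (hs.nat_le a' i') (show N ≤ N + (i.ops + e.ops + 1) by omega)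
      by_cases ha : a' = a
      · subst ha
        simp only [State.setNat, Function.update_self, Function.update_apply]
        split_ifs
        · exact h3
        · exact h4
      · simpa only [State.setNat, Function.update_of_ne ha] using h4
    · rw [mul_add, mul_add]
      omega
  | setFld a i e s =>
    intro N H hs hc hdH hW hB
    simp only [NatExpr.price_unit, FldExpr.price_unit] at hW hB ⊢
    simp only [add_mul] at hB
    have h1 := (hs.price_nat hc i hp.1 (W := W) (by omega)).trans
      (Nat.mul_le_mul_right _ (show W + 2 ≤ 2 * B + W + 3 by omega))
    have h2 := hs.price_fld hc hd hdH e hp.2 (W := W) (B := B) (by omega) (by omega)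
    refine ⟨⟨fun a' i' => hpow (hs.nat_le a' i') (by omega), fun a' i' => ?_⟩, _, ?_,
      .setFld a i e s⟩
    · have h3 := (hs.eval_fld hc hd hdH e hp.2 (W := W) (by omega)).mono
        (show _ ≤ H + (i.ops + e.ops + 1) * (W + 1) by simp only [add_mul]; omega)
      have h4 := (hs.fld_isMultiple a' i').mono
        (show H ≤ H + (i.ops + e.ops + 1) * (W + 1) by omega)
      by_cases ha : a' = a
      · subst ha
        simp only [State.setFld, Function.update_self, Function.update_apply]
        split_ifs
        · exact h3
        · exact h4
      · simpa only [State.setFld, Function.update_of_ne ha] using h4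
    · rw [mul_add, mul_add]
      omega
  -- The second program starts with the enlarged `N` and `H` that the first one leaves, whereas `W`
  -- and `B` bound the sizes over the entire run and stay fixed.
  | seq _ _ ih₁ ih₂ =>
    intro N H hs hc hdH hW hB
    rw [add_mul] at hB
    obtain ⟨hs₁, t₁, ht₁, hr₁⟩ := ih₁ hp.1 hs hc hdH (by omega) (by omega)
    obtain ⟨hs₂, t₂, ht₂, hr₂⟩ := ih₂ hp.2 hs₁ (hpow hc (by omega)) (hpow hdH (by omega))
      (by omega) (by omega)
    refine ⟨hs₂.mono (by omega) (by rw [add_mul]; omega), _, ?_, .seq hr₁ hr₂⟩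
    rw [mul_add]
    omega
  | @iteTrue b _ _ _ _ _ hb _ ih =>
    intro N H hs hc hdH hW hB
    rw [Test.price_unit] at hW hB ⊢
    rw [add_mul] at hB
    have h1 := hs.price_test hc hd hdH b hp.1 (W := W) (B := B) (by omega) (by omega)
    obtain ⟨hs₁, t₁, ht₁, hr₁⟩ := ih hp.2.1 hs hc hdH (by omega) (by omega)
    refine ⟨hs₁.mono (by omega) (by rw [add_mul]; omega), _, ?_, .iteTrue hb hr₁⟩
    rw [mul_add]
    omega
  | @iteFalse b _ _ _ _ _ hb _ ih =>
    intro N H hs hc hdH hW hB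
    rw [Test.price_unit] at hW hB ⊢
    rw [add_mul] at hB
    have h1 := hs.price_test hc hd hdH b hp.1 (W := W) (B := B) (by omega) (by omega)
    obtain ⟨hs₁, t₁, ht₁, hr₁⟩ := ih hp.2.2 hs hc hdH (by omega) (by omega)
    refine ⟨hs₁.mono (by omega) (by rw [add_mul]; omega), _, ?_, .iteFalse hb hr₁⟩
    rw [mul_add]
    omega
  | @loopTrue b _ _ _ _ _ _ hb _ _ ih₁ ih₂ =>
    intro N H hs hc hdH hW hB
    rw [Test.price_unit] at hW hB ⊢
    rw [add_mul, add_mul] at hB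
    have h1 := hs.price_test hc hd hdH b hp.1 (W := W) (B := B) (by omega) (by omega)
    obtain ⟨hs₁, t₁, ht₁, hr₁⟩ := ih₁ hp.2 hs hc hdH (by omega) (by omega)
    obtain ⟨hs₂, t₂, ht₂, hr₂⟩ := ih₂ hp hs₁ (hpow hc (by omega)) (hpow hdH (by omega))
      (by omega) (by omega)
    refine ⟨hs₂.mono (by omega) (by rw [add_mul, add_mul]; omega), _, ?_, .loopTrue hb hr₁ hr₂⟩
    rw [mul_add, mul_add]
    omega
  | @loopFalse b _ s hb =>
    intro N H hs hc hdH hW hB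
    rw [Test.price_unit] at hW hB ⊢
    exact ⟨hs.mono (by omega) (by omega), _,
      hs.price_test hc hd hdH b hp.1 (W := W) (B := B) (by omega) (by omega), .loopFalse hb⟩

end FieldRAM

namespace KMedian

open FieldRAM

/-! ### Bit lengths of rational instances -/

lemma ratBits_pos (q : ℚ) : 1 ≤ ratBits q := by
  have : 0 < Nat.size q.den := Nat.size_pos.2 q.den_pos
  unfold ratBits
  omega

lemma size_le_bitSize (I : KMedian ℚ) : I.size ≤ I.bitSize := by
  have : I.edges.card ≤ ∑ p ∈ I.edges, ratBits (I.cost p.1 p.2) := by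
    rw [Finset.card_eq_sum_ones]
    exact Finset.sum_le_sum fun p _ => ratBits_pos _
  unfold size bitSize
  omega

lemma ratBits_le_bitSize (I : KMedian ℚ) {p : Fin I.centers × Fin I.customers} (hp : p ∈ I.edges) :
    ratBits (I.cost p.1 p.2) ≤ I.bitSize := by
  have := Finset.single_le_sum (f := fun p => ratBits (I.cost p.1 p.2)) (fun _ _ => Nat.zero_le _) hp
  unfold bitSize
  omega

/-- A common denominator of all costs. -/
def denom (I : KMedian ℚ) : ℕ := ∏ p ∈ I.edges, (I.cost p.1 p.2).den

lemma denom_pos (I : KMedian ℚ) : 0 < I.denom := Finset.prod_pos fun _ _ => Rat.den_pos _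

lemma denom_le (I : KMedian ℚ) : I.denom ≤ 2 ^ I.bitSize := by
  have h1 : I.denom ≤ ∏ p ∈ I.edges, 2 ^ ratBits (I.cost p.1 p.2) := by
    refine Finset.prod_le_prod' fun p _ => ?_
    refine (Nat.lt_size_self _).le.trans (Nat.pow_le_pow_right (by norm_num) ?_)
    exact Nat.le_add_left _ _
  rw [Finset.prod_pow_eq_pow_sum] at h1
  exact h1.trans (Nat.pow_le_pow_right (by norm_num) (Nat.le_add_left _ _))

/-- Expanding to the common denominator multiplies the numerator by a cofactor of at most `I.denom`,
whence twice the bit size. -/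
lemma isMultiple_cost (I : KMedian ℚ) {p : Fin I.centers × Fin I.customers} (hp : p ∈ I.edges) :
    IsMultiple I.denom (2 * I.bitSize) (I.cost p.1 p.2) := by
  have hbits := I.ratBits_le_bitSize hp
  obtain ⟨a, ha⟩ : (I.cost p.1 p.2).den ∣ I.denom :=
    Finset.dvd_prod_of_mem (fun p => (I.cost p.1 p.2).den) hp
  have hd := I.denom_pos
  have ha' : a ≤ I.denom := by
    rw [ha]
    exact Nat.le_mul_of_pos_left _ (Rat.den_pos _)
  have ha0 : a ≠ 0 := by
    rintro rfl
    simp [ha] at hd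
  refine ⟨(I.cost p.1 p.2).num * a, ?_, ?_⟩
  · conv_lhs => rw [← Rat.num_div_den (I.cost p.1 p.2)]
    have h1 : ((I.cost p.1 p.2).den : ℚ) ≠ 0 := by exact_mod_cast Rat.den_ne_zero _
    have h2 : (a : ℚ) ≠ 0 := by exact_mod_cast ha0
    rw [ha]
    push_cast
    field_simp
  · rw [abs_mul, two_mul, pow_add, Nat.abs_cast, Int.abs_eq_natAbs]
    have h1 : (I.cost p.1 p.2).num.natAbs ≤ 2 ^ I.bitSize := by
      refine (Nat.lt_size_self _).le.trans (Nat.pow_le_pow_right (by norm_num) ?_)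
      exact (Nat.le_add_right _ _).trans hbits
    have h2 := ha'.trans I.denom_le
    exact_mod_cast Nat.mul_le_mul h1 h2

lemma input_bounded (I : KMedian ℚ) {k : ℕ} (enum : Fin I.edges.card ≃ I.edges)
    (hk : k ≤ I.customers) (c : ℕ) :
    (I.input k enum).Bounded I.denom (I.bitSize + c) (2 * I.bitSize) := by
  have hsize := I.size_le_bitSize
  unfold size at hsize
  have hlt : ∀ x, x ≤ I.bitSize → x ≤ 2 ^ (I.bitSize + c) := fun x hx =>
    hx.trans (Nat.lt_two_pow_self.le.trans (Nat.pow_le_pow_right (by norm_num) (by omega)))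
  refine ⟨fun a i => hlt _ ?_, fun a i => ?_⟩
  · match a with
    | 0 =>
      simp only [input]
      match i with
      | 0 => simp; omega
      | 1 => simp; omega
      | 2 => simp; omega
      | 3 => simp; omega
      | i + 4 => simp
    | 1 =>
      simp only [input]
      split_ifs with h
      · exact (Fin.is_lt _).le.trans (by omega)
      · omega
    | 2 =>
      simp only [input]
      split_ifs with h
      · exact (Fin.is_lt _).le.trans (by omega)
      · omega
    | a + 3 => simp [input]
  · have hzero : IsMultiple I.denom (2 * I.bitSize) 0 := ⟨0, by simp, by simp⟩
    match a with
    | 0 =>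
      simp only [input]
      split_ifs with h
      · exact I.isMultiple_cost (enum ⟨i, h⟩).2
      · exact hzero
    | a + 1 => exact hzero

lemma eval_mono_nat (P : Polynomial ℕ) {x y : ℕ} (h : x ≤ y) : P.eval x ≤ P.eval y := by
  rw [Polynomial.eval_eq_sum, Polynomial.eval_eq_sum]
  exact Finset.sum_le_sum fun i _ => Nat.mul_le_mul_left _ (Nat.pow_le_pow_left h i)

/-- For linear programs, polynomially many operations take polynomial time in the bit model. -/
theorem SizeApproximates.exists_bit {A : Prog} {c : ℕ} (hA : A.Linear c) {α : ℕ → ℕ → ℝ}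
    {P : Polynomial ℕ} (h : SizeApproximates A α (unitPricing ℚ) size P) :
    ∃ Q : Polynomial ℕ, (∀ x, P.eval x ≤ Q.eval x) ∧
      SizeApproximates A α bitPricing bitSize Q := by
  let W : Polynomial ℕ := Polynomial.X + Polynomial.C c + P
  let B : Polynomial ℕ := 2 * Polynomial.X + P * (W + 1)
  refine ⟨(2 * B + W + 3) * P, fun x => ?_, fun I k enum hk hn hkn => ?_⟩
  -- `Q` dominates `P`, so that one polynomial can serve both cost models.
  · simp only [Polynomial.eval_mul, Polynomial.eval_add, Polynomial.eval_ofNat]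
    exact Nat.le_mul_of_pos_left _ (by omega)
  obtain ⟨t, s, hrun, ht, hsol⟩ := h I k enum hk hn hkn
  have htP := ht.trans (eval_mono_nat P I.size_le_bitSize)
  have hWeval : W.eval I.bitSize = I.bitSize + c + P.eval I.bitSize := by simp [W]
  have hBeval : B.eval I.bitSize =
      2 * I.bitSize + P.eval I.bitSize * (W.eval I.bitSize + 1) := by simp [B]
  have hlt : ∀ x y, x ≤ y → x ≤ 2 ^ y := fun x y hx =>
    Nat.lt_two_pow_self.le.trans (Nat.pow_le_pow_right (by norm_num) hx)
  obtain ⟨-, t', ht', hrun'⟩ := hrun.exists_bit_run hA I.denom_pos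
    (I.input_bounded enum (by omega) c) (hlt _ _ (by omega))
    (I.denom_le.trans (Nat.pow_le_pow_right (by norm_num) (by omega)))
    (W := W.eval I.bitSize) (B := B.eval I.bitSize) (by omega)
    (by rw [hBeval]; gcongr)
  refine ⟨t', s, hrun', ht'.trans ?_, hsol⟩
  simp only [Polynomial.eval_mul, Polynomial.eval_add, Polynomial.eval_ofNat]
  gcongr

end KMedian

/-! ### Verification of programs -/

namespace FieldRAM

/-- The names of the arrays of natural numbers that a program writes. -/
def Prog.natMods : Prog → List ℕ
  | .skip => []
  | .setNat a _ _ => [a]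
  | .setFld _ _ _ => []
  | .seq p q => p.natMods ++ q.natMods
  | .ite _ p q => p.natMods ++ q.natMods
  | .loop _ p => p.natMods

/-- The names of the arrays of field elements that a program writes. -/
def Prog.fldMods : Prog → List ℕ
  | .skip => []
  | .setNat _ _ _ => []
  | .setFld a _ _ => [a]
  | .seq p q => p.fldMods ++ q.fldMods
  | .ite _ p q => p.fldMods ++ q.fldMods
  | .loop _ p => p.fldMods

/-- The number of operations in the text of a program (tests of loops count twice). -/
def Prog.weight : Prog → ℕ
  | .skip => 1
  | .setNat _ i e => i.ops + e.ops + 1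
  | .setFld _ i e => i.ops + e.ops + 1
  | .seq p q => p.weight + q.weight
  | .ite b p q => b.ops + p.weight + q.weight
  | .loop b p => 2 * b.ops + p.weight

variable {K : Type}

@[simp] lemma State.setNat_fld (s : State K) (a i v : ℕ) : (s.setNat a i v).fld = s.fld := rfl

@[simp] lemma State.setFld_nat (s : State K) (a i : ℕ) (v : K) : (s.setFld a i v).nat = s.nat := rfl

@[simp] lemma State.setNat_nat_self (s : State K) (a i v : ℕ) :
    (s.setNat a i v).nat a = Function.update (s.nat a) i v := by simp [State.setNat]

@[simp] lemma State.setFld_fld_self (s : State K) (a i : ℕ) (v : K) :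
    (s.setFld a i v).fld a = Function.update (s.fld a) i v := by simp [State.setFld]

@[simp] lemma State.setNat_nat_of_ne (s : State K) {a b : ℕ} (h : b ≠ a) (i v : ℕ) :
    (s.setNat a i v).nat b = s.nat b := by simp [State.setNat, h]

@[simp] lemma State.setFld_fld_of_ne (s : State K) {a b : ℕ} (h : b ≠ a) (i : ℕ) (v : K) :
    (s.setFld a i v).fld b = s.fld b := by simp [State.setFld, h]

/-- The two states agree on all arrays that the program does not write. -/
structure Frame (p : Prog) (s s' : State K) : Prop where
  nat : ∀ a, a ∉ p.natMods → s'.nat a = s.nat a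
  fld : ∀ a, a ∉ p.fldMods → s'.fld a = s.fld a

lemma Frame.refl (p : Prog) (s : State K) : Frame p s s := ⟨fun _ _ => rfl, fun _ _ => rfl⟩

lemma Frame.trans {p : Prog} {s s' s'' : State K} (h : Frame p s s') (h' : Frame p s' s'') :
    Frame p s s'' :=
  ⟨fun a ha => (h'.nat a ha).trans (h.nat a ha), fun a ha => (h'.fld a ha).trans (h.fld a ha)⟩

lemma Frame.mono {p q : Prog} {s s' : State K} (h : Frame p s s')
    (h₁ : ∀ a ∈ p.natMods, a ∈ q.natMods) (h₂ : ∀ a ∈ p.fldMods, a ∈ q.fldMods) :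
    Frame q s s' :=
  ⟨fun a ha => h.nat a fun h => ha (h₁ a h), fun a ha => h.fld a fun h => ha (h₂ a h)⟩

variable [Field K] [LinearOrder K]

lemma Run.frame {M : Pricing K} {p : Prog} {s s' : State K} {t : ℕ} (h : Run M p s t s') :
    Frame p s s' := by
  induction h with
  | skip s => exact .refl _ _
  | setNat a i e s => exact ⟨fun b hb => by simp_all [Prog.natMods], fun _ _ => rfl⟩
  | setFld a i e s => exact ⟨fun _ _ => rfl, fun b hb => by simp_all [Prog.fldMods]⟩
  | seq _ _ ih₁ ih₂ =>
    refine (ih₁.mono ?_ ?_).trans (ih₂.mono ?_ ?_) <;>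
      intro a ha <;> simp [Prog.natMods, Prog.fldMods, ha]
  | iteTrue _ _ ih => refine ih.mono ?_ ?_ <;> intro a ha <;> simp [Prog.natMods, Prog.fldMods, ha]
  | iteFalse _ _ ih => refine ih.mono ?_ ?_ <;> intro a ha <;> simp [Prog.natMods, Prog.fldMods, ha]
  | loopTrue _ _ _ ih₁ ih₂ => exact Frame.trans (ih₁.mono (fun _ h => h) fun _ h => h) ih₂
  | loopFalse _ => exact .refl _ _

/-- Started in `s`, the program `p` halts in a state with the property `Q`, after a number of
operations that is at most its weight times `(B + 1) ^ d`. -/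
def Halts (B d : ℕ) (p : Prog) (s : State K) (Q : State K → Prop) : Prop :=
  ∃ t s', Run (unitPricing K) p s t s' ∧ t ≤ p.weight * (B + 1) ^ d ∧ Q s'

/-! ### Program logic with time bounds -/

variable {B d : ℕ} {s : State K}

lemma Halts.mono_exp {p : Prog} {Q : State K → Prop} {d' : ℕ} (h : Halts B d p s Q)
    (hd : d ≤ d') : Halts B d' p s Q := by
  obtain ⟨t, s', hr, ht, hQ⟩ := h
  exact ⟨t, s', hr, ht.trans (Nat.mul_le_mul_left _ (Nat.pow_le_pow_right (Nat.succ_pos _) hd)), hQ⟩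

lemma Halts.imp {p : Prog} {Q R : State K → Prop} (h : Halts B d p s Q)
    (hQR : ∀ s', Frame p s s' → Q s' → R s') : Halts B d p s R := by
  obtain ⟨t, s', hr, ht, hQ⟩ := h
  exact ⟨t, s', hr, ht, hQR s' hr.frame hQ⟩

lemma Halts.skip {Q : State K → Prop} (h : Q s) : Halts B d .skip s Q :=
  ⟨1, s, .skip s, by simpa [Prog.weight] using Nat.one_le_pow _ _ (Nat.succ_pos _), h⟩

lemma Halts.setNat {a : ℕ} {i e : NatExpr} {Q : State K → Prop}
    (h : Q (s.setNat a (i.eval s) (e.eval s))) : Halts B d (.setNat a i e) s Q := by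
  refine ⟨_, _, .setNat a i e s, ?_, h⟩
  rw [NatExpr.price_unit, NatExpr.price_unit]
  exact Nat.le_mul_of_pos_right _ (Nat.pow_pos (Nat.succ_pos _))

lemma Halts.setFld {a : ℕ} {i : NatExpr} {e : FldExpr} {Q : State K → Prop}
    (h : Q (s.setFld a (i.eval s) (e.eval s))) : Halts B d (.setFld a i e) s Q := by
  refine ⟨_, _, .setFld a i e s, ?_, h⟩
  rw [NatExpr.price_unit, FldExpr.price_unit]
  exact Nat.le_mul_of_pos_right _ (Nat.pow_pos (Nat.succ_pos _))

lemma Halts.seq {p q : Prog} {Q R : State K → Prop} (hp : Halts B d p s R)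
    (hq : ∀ s', Frame p s s' → R s' → Halts B d q s' Q) : Halts B d (.seq p q) s Q := by
  obtain ⟨t, s', hr, ht, hR⟩ := hp
  obtain ⟨t', s'', hr', ht', hQ⟩ := hq s' hr.frame hR
  refine ⟨_, s'', .seq hr hr', ?_, hQ⟩
  rw [Prog.weight, add_mul]
  omega

lemma Halts.ite {b : Test} {p q : Prog} {Q : State K → Prop} (hp : b.holds s → Halts B d p s Q)
    (hq : ¬ b.holds s → Halts B d q s Q) : Halts B d (.ite b p q) s Q := by
  have hb : b.ops ≤ b.ops * (B + 1) ^ d :=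
    Nat.le_mul_of_pos_right b.ops (Nat.pow_pos (Nat.succ_pos B))
  by_cases h : b.holds s
  · obtain ⟨t, s', hr, ht, hQ⟩ := hp h
    refine ⟨_, s', .iteTrue h hr, ?_, hQ⟩
    rw [Test.price_unit, Prog.weight, add_mul, add_mul]
    omega
  · obtain ⟨t, s', hr, ht, hQ⟩ := hq h
    refine ⟨_, s', .iteFalse h hr, ?_, hQ⟩
    rw [Test.price_unit, Prog.weight, add_mul, add_mul]
    omega

/-- At most `N` rounds multiply the time by `(B + 1) ^ a`. The final failing test is one more
evaluation of `b`, which the doubled weight of loop tests pays for. -/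
lemma Halts.loop {b : Test} {p : Prog} {a N : ℕ} (Inv : ℕ → State K → Prop) (h0 : Inv 0 s)
    (hstep : ∀ i s', Frame (.loop b p) s s' → Inv i s' → b.holds s' →
      i < N ∧ Halts B d p s' (Inv (i + 1))) (hN : N ≤ (B + 1) ^ a) :
    Halts B (d + a) (.loop b p) s (fun s' => ∃ i ≤ N, Inv i s' ∧ ¬ b.holds s') := by
  -- Induction on `m`, a bound for the number of rounds still to come.
  have key : ∀ m i s', N ≤ i + m → i ≤ N → Frame (.loop b p) s s' → Inv i s' →
      ∃ t s'', Run (unitPricing K) (.loop b p) s' t s'' ∧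
        t ≤ m * (b.ops + p.weight * (B + 1) ^ d) + b.ops ∧
        ∃ i ≤ N, Inv i s'' ∧ ¬ b.holds s'' := by
    intro m
    induction m with
    | zero =>
      intro i s' hi hiN hf hinv
      have hb : ¬ b.holds s' := fun hb => by
        have := (hstep i s' hf hinv hb).1
        omega
      exact ⟨_, s', .loopFalse hb, by rw [Test.price_unit]; omega, i, hiN, hinv, hb⟩
    | succ m ih =>
      intro i s' hi hiN hf hinv
      by_cases hb : b.holds s'
      · obtain ⟨hlt, t, s₁, hr, ht, hinv'⟩ := hstep i s' hf hinv hb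
        obtain ⟨t', s₂, hr', ht', hend⟩ := ih (i + 1) s₁ (by omega) hlt
          (hf.trans (hr.frame.mono (fun _ h => h) fun _ h => h)) hinv'
        refine ⟨_, s₂, .loopTrue hb hr hr', ?_, hend⟩
        rw [Test.price_unit, add_mul]
        omega
      · exact ⟨_, s', .loopFalse hb, by rw [Test.price_unit]; omega, i, hiN, hinv, hb⟩
  obtain ⟨t, s', hr, ht, hend⟩ := key N 0 s (by omega) (by omega) (.refl _ _) h0
  refine ⟨t, s', hr, ht.trans ?_, hend⟩
  have h1 : N * (b.ops + p.weight * (B + 1) ^ d) ≤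
      (B + 1) ^ a * (b.ops * (B + 1) ^ d + p.weight * (B + 1) ^ d) :=
    Nat.mul_le_mul hN (Nat.add_le_add_right
      (Nat.le_mul_of_pos_right _ (Nat.pow_pos (Nat.succ_pos _))) _)
  have h2 := Nat.le_mul_of_pos_right b.ops (Nat.pow_pos (n := d + a) (Nat.succ_pos B))
  calc N * (b.ops + p.weight * (B + 1) ^ d) + b.ops
      ≤ (B + 1) ^ a * (b.ops * (B + 1) ^ d + p.weight * (B + 1) ^ d) +
        b.ops * (B + 1) ^ (d + a) := Nat.add_le_add h1 h2
    _ = _ := by rw [Prog.weight, pow_add]; ring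

/-- Read the variable (the entry with index `0` of the array) with the given name. -/
def NatExpr.var (a : ℕ) : NatExpr := .get a (.lit 0)

/-- Read the variable (the entry with index `0` of the array) with the given name. -/
def FldExpr.var (a : ℕ) : FldExpr := .get a (.lit 0)

/-- Run `p` with the values `0, 1, …, bound - 1` of the variable `v`. -/
def Prog.forLoop (v : ℕ) (bound : NatExpr) (p : Prog) : Prog :=
  .seq (.setNat v (.lit 0) (.lit 0))
    (.loop (.natLe (.add (.var v) (.lit 1)) bound)
      (.seq p (.setNat v (.lit 0) (.add (.var v) (.lit 1)))))

/-- The bound is evaluated afresh in each round, so it must be stable under everything that the loop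
writes; `hset` says that the invariant ignores the counter variable. -/
lemma Halts.forLoop {v : ℕ} {bound : NatExpr} {p : Prog} {N : ℕ} {a : ℕ} (Inv : ℕ → State K → Prop)
    (hv : v ∉ p.natMods) (hN : N ≤ (B + 1) ^ a)
    (hbound : ∀ s', Frame (.forLoop v bound p) s s' → bound.eval s' = N)
    (hset : ∀ i s' x, Inv i s' → Inv i (s'.setNat v 0 x)) (h0 : Inv 0 s)
    (hstep : ∀ i < N, ∀ s', Frame (.forLoop v bound p) s s' → s'.nat v 0 = i → Inv i s' →
      Halts B d p s' (Inv (i + 1))) :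
    Halts B (d + a) (.forLoop v bound p) s (Inv N) := by
  refine Halts.seq (.setNat (Q := fun s' => s'.nat v 0 = 0 ∧ Inv 0 s') ?_) fun s₁ hf₁ h₁ => ?_
  · exact ⟨by simp [NatExpr.eval], hset 0 s _ h0⟩
  have hf₁ : Frame (.forLoop v bound p) s s₁ := hf₁.mono
    (fun a ha => List.mem_append_left _ ha) (fun a ha => List.mem_append_left _ ha)
  have hfr : ∀ s', Frame (.loop (.natLe (.add (.var v) (.lit 1)) bound)
      (.seq p (.setNat v (.lit 0) (.add (.var v) (.lit 1))))) s₁ s' →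
      Frame (.forLoop v bound p) s s' := fun s' hf => hf₁.trans <| hf.mono
    (fun a ha => List.mem_append_right _ ha) (fun a ha => List.mem_append_right _ ha)
  refine (Halts.loop (N := N) (fun i s' => i ≤ N ∧ s'.nat v 0 = i ∧ Inv i s')
    ⟨Nat.zero_le _, h₁.1, h₁.2⟩ ?_ hN).imp ?_
  · rintro i s' hf ⟨-, hi, hinv⟩ hb
    have hlt : i < N := by
      simp only [Test.holds, NatExpr.eval, NatExpr.var] at hb
      rw [hbound s' (hfr s' hf), hi] at hb
      omega
    refine ⟨hlt, (hstep i hlt s' (hfr s' hf) hi hinv).seq fun s₂ hf₂ hinv₂ => .setNat ?_⟩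
    have : s₂.nat v 0 = i := by rw [hf₂.nat v hv, hi]
    refine ⟨hlt, ?_, hset _ _ _ hinv₂⟩
    simp [NatExpr.eval, NatExpr.var, this]
  · rintro s' hf ⟨i, -, ⟨hiN, hi, hinv⟩, hb⟩
    simp only [Test.holds, NatExpr.eval, NatExpr.var] at hb
    rw [hbound s' (hfr s' hf), hi] at hb
    have : i = N := by omega
    exact this ▸ hinv

end FieldRAM

/-! ### The program

Arrays of natural numbers: `0` sizes, `1` and `2` ends of the edges, `3` output, `4` cheapest center
of each customer, `5` indicator of the current set. Variables: `6` number of greedy steps, `7`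
current center, `8` best center, `9` edge, `10` customer, `11` center, `12` greedy step, `13` and
`14` multiplier of the cap, `15` edge that gives the cap, `16` filling step, `17` worst customer.

Arrays of field elements: `0` costs, `2` least costs, `3` and `4` costs of the customers for the
current and for the tentative set. Variables: `1` cost of a non-edge, `5` accumulator, `6` best
potential, `7` cap, `8` unit of the cap, `9` best total cost, `10` and `11` powers. -/

namespace KMedian

open FieldRAM

/-- Lower the costs in array `f` of the customers of the current center. -/
def addCenter (f : ℕ) : Prog :=
  .forLoop 9 (.get 0 (.lit 2)) <|
    -- Equality of two naturals: both truncated differences vanish.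
    .ite (.natLe (.add (.sub (.get 1 (.var 9)) (.var 7)) (.sub (.var 7) (.get 1 (.var 9)))) (.lit 0))
      (.ite (.fldLe (.get 0 (.var 9)) (.get f (.get 2 (.var 9))))
        (.setFld f (.get 2 (.var 9)) (.get 0 (.var 9))) .skip) .skip

/-- The scaled excess of the current customer for the costs in array `f`. -/
def excessExpr (f : ℕ) : FldExpr :=
  .mul (.ofNat (.get 0 (.lit 1))) (.sub (.get f (.var 10)) (.get 2 (.var 10)))

/-- The potential of the tentative set. -/
def computePotential : Prog :=
  .seq (.setFld 5 (.lit 0) (.ofNat (.lit 0))) <|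
  .forLoop 10 (.get 0 (.lit 1)) <|
    .ite (.fldLe (.var 7) (excessExpr 4))
      (.setFld 5 (.lit 0) (.add (.var 5) (.var 7)))
      (.setFld 5 (.lit 0) (.add (.var 5) (excessExpr 4)))

/-- The potential of the current set together with the current center. -/
def tryCenter : Prog :=
  .seq (.forLoop 10 (.get 0 (.lit 1)) (.setFld 4 (.var 10) (.get 3 (.var 10)))) <|
  .seq (addCenter 4) computePotential

/-- Add the current center to the current set. -/
def commitCenter : Prog :=
  .seq (addCenter 3) (.setNat 5 (.var 7) (.lit 1))

/-- Add a center that minimizes the potential. -/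
def greedyStep : Prog :=
  .seq (.setNat 7 (.lit 0) (.lit 0)) <|
  .seq tryCenter <|
  .seq (.setFld 6 (.lit 0) (.var 5)) <|
  .seq (.setNat 8 (.lit 0) (.lit 0)) <|
  .seq (.forLoop 11 (.get 0 (.lit 0)) <|
    .seq (.setNat 7 (.lit 0) (.var 11)) <|
    .seq tryCenter <|
    .ite (.fldLe (.var 5) (.var 6))
      (.seq (.setFld 6 (.lit 0) (.var 5)) (.setNat 8 (.lit 0) (.var 11))) .skip) <|
  .seq (.setNat 7 (.lit 0) (.var 8)) commitCenter

/-- Add the cheapest center of a customer with the largest excess. -/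
def fillStep : Prog :=
  .seq (.setNat 17 (.lit 0) (.lit 0)) <|
  .seq (.forLoop 10 (.get 0 (.lit 1)) <|
    .ite (.fldLe (.sub (.get 3 (.var 17)) (.get 2 (.var 17)))
        (.sub (.get 3 (.var 10)) (.get 2 (.var 10))))
      (.setNat 17 (.lit 0) (.var 10)) .skip) <|
  .seq (.setNat 7 (.lit 0) (.get 4 (.var 17))) commitCenter

/-- The candidate for the current cap. -/
def computeCandidate : Prog :=
  .seq (.forLoop 10 (.get 0 (.lit 1)) (.setFld 3 (.var 10) (.var 1))) <|
  .seq (.forLoop 11 (.get 0 (.lit 0)) (.setNat 5 (.var 11) (.lit 0))) <|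
  .seq (.forLoop 12 (.var 6) greedyStep) <|
  -- By truncation, `n - (n - 2k)` is `min(n, 2k)`.
  .forLoop 16 (.sub (.get 0 (.lit 1)) (.sub (.get 0 (.lit 1))
    (.add (.get 0 (.lit 3)) (.get 0 (.lit 3))))) fillStep

/-- Compute the total cost of the current set, and output this set if it is the best so far. -/
def keepBest : Prog :=
  .seq (.setFld 5 (.lit 0) (.ofNat (.lit 0))) <|
  .seq (.forLoop 10 (.get 0 (.lit 1)) <|
    .setFld 5 (.lit 0) (.add (.var 5) (.get 3 (.var 10)))) <|
  .ite (.fldLe (.var 5) (.var 9))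
    (.seq (.setFld 9 (.lit 0) (.var 5)) <|
      .forLoop 11 (.get 0 (.lit 0)) (.setNat 3 (.var 11) (.get 5 (.var 11)))) .skip

/-- Try all caps. -/
def search : Prog :=
  .forLoop 15 (.add (.get 0 (.lit 2)) (.lit 1)) <|
  .seq (.ite (.natLe (.add (.var 15) (.lit 1)) (.get 0 (.lit 2)))
    (.setFld 8 (.lit 0) (.sub (.get 0 (.var 15)) (.get 2 (.get 2 (.var 15)))))
    (.setFld 8 (.lit 0) (.ofNat (.lit 1)))) <|
  .seq (.setFld 7 (.lit 0) (.ofNat (.lit 0))) <|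
  -- Two nested loops give `(n + 1)²` rounds without a product of naturals; the cap grows by one
  -- unit in each.
  .forLoop 13 (.add (.get 0 (.lit 1)) (.lit 1)) <|
  .forLoop 14 (.add (.get 0 (.lit 1)) (.lit 1)) <|
  .seq (.setFld 7 (.lit 0) (.add (.var 7) (.var 8))) <|
  .seq computeCandidate keepBest

/-- The cost of a non-edge and the cheapest centers of the customers. -/
def prepare : Prog :=
  .seq (.setFld 1 (.lit 0) (.ofNat (.lit 1))) <|
  .seq (.forLoop 9 (.get 0 (.lit 2)) (.setFld 1 (.lit 0) (.add (.var 1) (.get 0 (.var 9))))) <|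
  .seq (.forLoop 10 (.get 0 (.lit 1)) (.setFld 2 (.var 10) (.var 1))) <|
  .seq (.forLoop 9 (.get 0 (.lit 2)) <|
    .ite (.fldLe (.get 0 (.var 9)) (.get 2 (.get 2 (.var 9))))
      (.seq (.setFld 2 (.get 2 (.var 9)) (.get 0 (.var 9)))
        (.setNat 4 (.get 2 (.var 9)) (.get 1 (.var 9)))) .skip) <|
  -- `n Z` is the total cost of the empty set, which is the initial output.
  .setFld 9 (.lit 0) (.mul (.ofNat (.get 0 (.lit 1))) (.var 1))

/-- The least number of greedy steps that suffices. -/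
def countSteps : Prog :=
  .seq (.setNat 6 (.lit 0) (.lit 0)) <|
  .seq (.setFld 10 (.lit 0) (.ofNat (.lit 1))) <|
  .seq (.setFld 11 (.lit 0) (.ofNat (.lit 1))) <|
  -- Adding `1` on the left turns `≤` between integers into `<`. The powers `(k-1)^i` and `k^i` are
  -- field elements because naturals cannot be multiplied.
  .loop (.fldLe
      (.add (.mul (.ofNat (.add (.get 0 (.lit 3)) (.get 0 (.lit 3)))) (.mul (.ofNat
        (.add (.add (.get 0 (.lit 3)) (.get 0 (.lit 3))) (.lit 1))) (.var 11))) (.ofNat (.lit 1)))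
      (.mul (.ofNat (.get 0 (.lit 1))) (.mul (.ofNat (.get 0 (.lit 1))) (.var 10)))) <|
    .seq (.setFld 10 (.lit 0) (.mul (.ofNat (.sub (.get 0 (.lit 3)) (.lit 1))) (.var 10))) <|
    .seq (.setFld 11 (.lit 0) (.mul (.ofNat (.get 0 (.lit 3))) (.var 11))) <|
    .setNat 6 (.lit 0) (.add (.var 6) (.lit 1))

/-- The approximation algorithm. -/
def program : Prog := .seq prepare (.seq countSteps search)

lemma program_linear : program.Linear 3 := by
  simp [program, prepare, countSteps, search, keepBest, computeCandidate, fillStep, greedyStep,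
    commitCenter, tryCenter, computePotential, excessExpr, addCenter, Prog.Linear, Prog.forLoop,
    Test.Linear, FldExpr.Linear, NatExpr.LitLe, NatExpr.var, FldExpr.var]

/-! ### Correctness of the search for a good cap -/

variable {K : Type} [Field K] [LinearOrder K]

/-- The data that the main loop of the program uses. -/
structure Setup (K : Type) [Field K] [LinearOrder K] extends CostMatrix K where
  U : ℕ
  m : ℕ
  k : ℕ
  t : ℕ
  B : ℕ
  ctr : ℕ → ℕ
  cust : ℕ → ℕ
  cost : ℕ → K
  U_le : U ≤ B
  n_pos : 0 < n
  n_le : n ≤ B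
  m_le : m ≤ B
  t_le : t ≤ (B + 1) ^ 3
  cust_lt : ∀ e < m, cust e < n
  c_edge : ∀ e < m, c (ctr e) (cust e) = cost e
  c_cases : ∀ x j, (∃ e < m, ctr e = x ∧ cust e = j) ∨ c x j = Z

/-- The data in the memory are those of `S`. -/
structure Setup.Agrees (S : Setup K) (s : State K) : Prop where
  U : s.nat 0 0 = S.U
  n : s.nat 0 1 = S.n
  m : s.nat 0 2 = S.m
  k : s.nat 0 3 = S.k
  t : s.nat 6 0 = S.t
  ctr : s.nat 1 = S.ctr
  cust : s.nat 2 = S.cust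
  best : s.nat 4 = S.best
  cost : s.fld 0 = S.cost
  low : s.fld 2 = S.low
  Z : s.fld 1 0 = S.Z

variable {S : Setup K} {s s' : State K}

lemma Setup.Agrees.frame (hs : S.Agrees s) {p : Prog} (h : Frame p s s')
    (h₁ : ∀ a ∈ [0, 1, 2, 4, 6], a ∉ p.natMods) (h₂ : ∀ a ∈ [0, 1, 2], a ∉ p.fldMods) :
    S.Agrees s' := by
  have e0 := h.nat 0 (h₁ 0 (by decide))
  have e1 := h.nat 1 (h₁ 1 (by decide))
  have e2 := h.nat 2 (h₁ 2 (by decide))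
  have e4 := h.nat 4 (h₁ 4 (by decide))
  have e6 := h.nat 6 (h₁ 6 (by decide))
  have f0 := h.fld 0 (h₂ 0 (by decide))
  have f1 := h.fld 1 (h₂ 1 (by decide))
  have f2 := h.fld 2 (h₂ 2 (by decide))
  obtain ⟨h1, h2, h3, h4, h5, h6, h7, h8, h9, h10, h11⟩ := hs
  constructor <;> simp only [*]

/-- Array `f` holds the costs of the customers for the set `C`. -/
def Setup.HasDist (S : Setup K) (f : ℕ) (C : Finset ℕ) (s : State K) : Prop :=
  ∀ j < S.n, s.fld f j = S.dist C j

/-- Scanning the edges suffices: a customer without an edge to the new center would pay `Z` there,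
which cannot improve its cost. The invariant splits the customers according to whether such an edge
has already been scanned. -/
lemma halts_addCenter {f : ℕ} (hf : f = 3 ∨ f = 4) {C : Finset ℕ} (hs : S.Agrees s)
    (hC : S.HasDist f C s) :
    Halts S.B 1 (addCenter f) s (S.HasDist f (insert (s.nat 7 0) C)) := by
  set x := s.nat 7 0 with hx
  refine (Halts.forLoop (B := S.B) (d := 0) (a := 1) (N := S.m) (fun e s' => ∀ j < S.n, s'.fld f j =
    if ∃ e' < e, S.ctr e' = x ∧ S.cust e' = j then S.dist (insert x C) j else S.dist C j)
    (by rcases hf with rfl | rfl <;> decide) (by have := S.m_le; simp only [pow_one]; omega) ?_ (fun _ _ _ h => h) ?_ ?_).imp ?_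
  · intro s' h
    have := h.nat 0 (by rcases hf with rfl | rfl <;> decide)
    simp [NatExpr.eval, this, hs.m]
  · intro j hj
    simpa using hC j hj
  · intro e he s' hfr hi hinv
    have hs' : S.Agrees s' := hs.frame hfr (by rcases hf with rfl | rfl <;> decide)
      (by rcases hf with rfl | rfl <;> decide)
    have h7 : s'.nat 7 0 = x := by rw [hfr.nat 7 (by rcases hf with rfl | rfl <;> decide)]
    have hsucc : ∀ j, (∃ e' < e + 1, S.ctr e' = x ∧ S.cust e' = j) ↔
        (∃ e' < e, S.ctr e' = x ∧ S.cust e' = j) ∨ S.ctr e = x ∧ S.cust e = j := by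
      intro j
      constructor
      · rintro ⟨e', he', h⟩
        rcases Nat.lt_succ_iff_lt_or_eq.1 he' with h' | rfl
        · exact Or.inl ⟨e', h', h⟩
        · exact Or.inr h
      · rintro (⟨e', he', h⟩ | h)
        · exact ⟨e', by omega, h⟩
        · exact ⟨e, by omega, h⟩
    have hval : S.ctr e = x → min (S.cost e) (s'.fld f (S.cust e)) = S.dist (insert x C) (S.cust e) := by
      intro h
      rw [hinv _ (S.cust_lt e he), ← S.c_edge e he, h]
      split_ifs
      · rw [S.dist_insert, ← min_assoc, min_self]
      · rw [S.dist_insert]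
    refine Halts.ite (fun ht => Halts.ite (fun ht' => .setFld ?_) fun ht' => .skip ?_) fun ht =>
      .skip ?_
    · simp only [Test.holds, NatExpr.eval, FldExpr.eval, NatExpr.var, hi, h7, hs'.ctr, hs'.cust,
        hs'.cost] at ht ht' ⊢
      have hcx : S.ctr e = x := by omega
      intro j hj
      rw [State.setFld_fld_self, Function.update_apply]
      simp only [hsucc, hcx, true_and]
      split_ifs with h1 h2 h2
      · rw [h1, ← hval hcx, min_eq_left ht']
      · exact absurd (Or.inr h1.symm) h2
      · rcases h2 with h2 | h2
        · rw [hinv j hj, if_pos h2]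
        · exact absurd h2.symm h1
      · rw [hinv j hj, if_neg fun h => h2 (Or.inl h)]
    · simp only [Test.holds, NatExpr.eval, FldExpr.eval, NatExpr.var, hi, h7, hs'.ctr, hs'.cust,
        hs'.cost] at ht ht' ⊢
      have hcx : S.ctr e = x := by omega
      intro j hj
      simp only [hsucc, hcx, true_and]
      by_cases h1 : S.cust e = j
      · rw [if_pos (Or.inr h1), ← h1, ← hval hcx, min_eq_right (not_le.1 ht').le]
      · rw [hinv j hj]
        simp [h1]
    · simp only [Test.holds, NatExpr.eval, NatExpr.var, hi, h7, hs'.ctr] at ht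
      have hcx : S.ctr e ≠ x := by omega
      intro j hj
      rw [hinv j hj]
      simp only [hsucc, hcx, false_and, or_false]
  · intro s' _ h j hj
    rw [h j hj]
    split_ifs with h1
    · rfl
    · rw [S.dist_insert, (S.c_cases x j).resolve_left h1, min_eq_right (S.dist_le_Z C j)]

end KMedian

namespace KMedian

open FieldRAM

variable {K : Type} [Field K] [LinearOrder K] {S : Setup K} {s : State K} {C : Finset ℕ}

lemma Setup.n_le_pow (S : Setup K) : S.n ≤ (S.B + 1) ^ 1 := by
  have := S.n_le
  simp only [pow_one]
  omega

lemma Setup.U_le_pow (S : Setup K) : S.U ≤ (S.B + 1) ^ 1 := by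
  have := S.U_le
  simp only [pow_one]
  omega

lemma Setup.Agrees.eval_excess (hs : S.Agrees s) {f j : ℕ} (hC : S.HasDist f C s) (hj : j < S.n)
    (h : s.nat 10 0 = j) : (excessExpr f).eval s = S.excess C j := by
  simp only [excessExpr, FldExpr.eval, NatExpr.eval, NatExpr.var, h, hs.n, hs.low, hC j hj]
  rfl

lemma halts_computePotential (hs : S.Agrees s) (hC : S.HasDist 4 C s) :
    Halts S.B 1 computePotential s (fun s' => s'.fld 5 0 = S.potential (s.fld 7 0) C) := by
  refine Halts.seq (R := fun s' => s'.fld 5 0 = 0) (.setFld ?_) fun s₁ hf₁ h₁ => ?_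
  · simp [FldExpr.eval, NatExpr.eval]
  have hs₁ : S.Agrees s₁ := hs.frame hf₁ (by decide) (by decide)
  refine Halts.forLoop (d := 0) (a := 1) (N := S.n) (fun i s' => s'.fld 5 0 =
    ∑ j ∈ Finset.range i, min (s.fld 7 0) (S.excess C j)) (by decide) S.n_le_pow ?_
    (fun _ _ _ h => h) (by simpa using h₁) ?_
  · intro s' hf
    rw [NatExpr.eval, NatExpr.eval, hf.nat 0 (by decide), hs₁.n]
  · intro i hi s' hf hv hinv
    have hs' : S.Agrees s' := hs₁.frame hf (by decide) (by decide)
    have h7 : s'.fld 7 0 = s.fld 7 0 := by rw [hf.fld 7 (by decide), hf₁.fld 7 (by decide)]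
    have hC' : S.HasDist 4 C s' := fun j hj => by
      rw [hf.fld 4 (by decide), hf₁.fld 4 (by decide), hC j hj]
    have he := hs'.eval_excess hC' hi hv
    refine Halts.ite (fun ht => .setFld ?_) fun ht => .setFld ?_
    · simp only [Test.holds, he] at ht
      simp only [FldExpr.eval, FldExpr.var, NatExpr.eval, h7] at ht ⊢
      simp [Finset.sum_range_succ, hinv, min_eq_left ht]
    · simp only [Test.holds, he] at ht
      simp only [FldExpr.eval, FldExpr.var, NatExpr.eval, h7] at ht
      simp only [FldExpr.eval.eq_3, he]
      simp [FldExpr.eval, FldExpr.var, NatExpr.eval, Finset.sum_range_succ, hinv,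
        min_eq_right (not_le.1 ht).le]

lemma halts_tryCenter (hs : S.Agrees s) (hC : S.HasDist 3 C s) :
    Halts S.B 1 tryCenter s
      (fun s' => s'.fld 5 0 = S.potential (s.fld 7 0) (insert (s.nat 7 0) C)) := by
  refine Halts.seq (R := S.HasDist 4 C) ?_ fun s₁ hf₁ h₁ => ?_
  · refine (Halts.forLoop (d := 0) (a := 1) (N := S.n) (fun i s' => ∀ j < i, s'.fld 4 j = s.fld 3 j)
      (by decide) S.n_le_pow ?_ (fun _ _ _ h => h) (by simp) ?_).imp ?_
    · intro s' hf
      rw [NatExpr.eval, NatExpr.eval, hf.nat 0 (by decide), hs.n]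
    · intro i hi s' hf hv hinv
      refine .setFld fun j hj => ?_
      simp only [FldExpr.eval, NatExpr.eval, NatExpr.var, hv, hf.fld 3 (by decide)]
      rw [State.setFld_fld_self, Function.update_apply]
      split_ifs with h
      · rw [h]
      · exact hinv j (by omega)
    · intro s' _ h j hj
      rw [h j hj, hC j hj]
  have hs₁ : S.Agrees s₁ := hs.frame hf₁ (by decide) (by decide)
  refine Halts.seq (halts_addCenter (Or.inr rfl) hs₁ h₁) fun s₂ hf₂ h₂ => ?_
  have hs₂ : S.Agrees s₂ := hs₁.frame hf₂ (by decide) (by decide)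
  refine (halts_computePotential hs₂ h₂).imp fun s₃ _ h₃ => ?_
  rw [h₃, hf₂.fld 7 (by decide), hf₁.fld 7 (by decide), hf₁.nat 7 (by decide)]

/-- The current set is `C`. -/
structure Setup.Current (S : Setup K) (C : Finset ℕ) (s : State K) : Prop where
  dist : S.HasDist 3 C s
  mem : ∀ x < S.U, s.nat 5 x ≠ 0 ↔ x ∈ C

lemma halts_commitCenter (hs : S.Agrees s) (hC : S.Current C s) :
    Halts S.B 1 commitCenter s (S.Current (insert (s.nat 7 0) C)) := by
  refine Halts.seq (halts_addCenter (Or.inl rfl) hs hC.dist) fun s₁ hf₁ h₁ => .setNat ⟨h₁, ?_⟩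
  intro x hx
  have h := hC.mem x hx
  simp only [NatExpr.eval, NatExpr.var]
  rw [State.setNat_nat_self, Function.update_apply, hf₁.nat 7 (by decide),
    hf₁.nat 5 (by decide), Finset.mem_insert]
  split_ifs with hx'
  · simp [hx']
  · rw [h]
    simp [hx']

lemma Setup.Current.frame {s' : State K} (hC : S.Current C s) {p : Prog} (h : Frame p s s')
    (h₁ : 5 ∉ p.natMods) (h₂ : 3 ∉ p.fldMods) : S.Current C s' :=
  ⟨fun j hj => by rw [h.fld 3 h₂, hC.dist j hj], fun x hx => by rw [h.nat 5 h₁, hC.mem x hx]⟩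

/-- The search starts from center `0`, so `x` need not be below `U` when there are no centers. This
is harmless, since `Greedy` does not restrict the chosen center. -/
lemma halts_greedyStep (hs : S.Agrees s) (hC : S.Current C s) :
    Halts S.B 2 greedyStep s (fun s' => ∃ x, S.Current (insert x C) s' ∧
      ∀ y < S.U, S.potential (s.fld 7 0) (insert x C) ≤ S.potential (s.fld 7 0) (insert y C)) := by
  refine Halts.seq (R := fun s' => s'.nat 7 0 = 0) (.setNat ?_) fun s₁ hf₁ h₁ => ?_
  · simp [NatExpr.eval]
  have hs₁ : S.Agrees s₁ := hs.frame hf₁ (by decide) (by decide)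
  have hC₁ := hC.frame hf₁ (by decide) (by decide)
  have hg₁ := hf₁.fld 7 (by decide)
  refine Halts.seq (R := fun s' => s'.fld 5 0 = S.potential (s.fld 7 0) (insert 0 C)) ?_
    fun s₂ hf₂ h₂ => ?_
  · refine ((halts_tryCenter hs₁ hC₁.dist).mono_exp (by omega)).imp fun s' hf h => ?_
    rwa [hg₁, h₁] at h
  have hs₂ := hs₁.frame hf₂ (by decide) (by decide)
  have hC₂ := hC₁.frame hf₂ (by decide) (by decide)
  have hg₂ := (hf₂.fld 7 (by decide)).trans hg₁
  refine Halts.seq (R := fun s' => s'.fld 6 0 = S.potential (s.fld 7 0) (insert 0 C)) (.setFld ?_)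
    fun s₃ hf₃ h₃ => ?_
  · simpa [FldExpr.eval, FldExpr.var, NatExpr.eval] using h₂
  have hs₃ := hs₂.frame hf₃ (by decide) (by decide)
  have hC₃ := hC₂.frame hf₃ (by decide) (by decide)
  have hg₃ := (hf₃.fld 7 (by decide)).trans hg₂
  refine Halts.seq (R := fun s' => s'.nat 8 0 = 0) (.setNat ?_) fun s₄ hf₄ h₄ => ?_
  · simp [NatExpr.eval]
  have hs₄ := hs₃.frame hf₄ (by decide) (by decide)
  have hC₄ := hC₃.frame hf₄ (by decide) (by decide)
  have hg₄ := (hf₄.fld 7 (by decide)).trans hg₃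
  have h6₄ := (congrFun (hf₄.fld 6 (by decide)) 0).trans h₃
  refine Halts.seq (Halts.forLoop (d := 1) (a := 1) (N := S.U) (fun i s' =>
      s'.fld 6 0 = S.potential (s.fld 7 0) (insert (s'.nat 8 0) C) ∧
      ∀ y < i, s'.fld 6 0 ≤ S.potential (s.fld 7 0) (insert y C))
    (by decide) S.U_le_pow ?_ (fun _ _ _ h => h) ⟨by rw [h6₄, h₄], by simp⟩ ?_)
    fun s₅ hf₅ h₅ => ?_
  · intro s' hf
    rw [NatExpr.eval, NatExpr.eval, hf.nat 0 (by decide), hs₄.U]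
  · rintro i - s' hf hv ⟨hinv₁, hinv₂⟩
    have hs' := hs₄.frame hf (by decide) (by decide)
    have hC' := hC₄.frame hf (by decide) (by decide)
    have hg' := (hf.fld 7 (by decide)).trans hg₄
    refine Halts.seq (R := fun s' => s'.nat 7 0 = i) (.setNat ?_) fun s₁ hf₁ h₁ => ?_
    · simp [NatExpr.eval, NatExpr.var, hv]
    have hs₁ := hs'.frame hf₁ (by decide) (by decide)
    have hC₁ := hC'.frame hf₁ (by decide) (by decide)
    have hg₁ := (hf₁.fld 7 (by decide)).trans hg'
    refine Halts.seq (halts_tryCenter hs₁ hC₁.dist) fun s₂ hf₂ h₂ => ?_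
    rw [hg₁, h₁] at h₂
    have h6 : s₂.fld 6 0 = s'.fld 6 0 := by rw [hf₂.fld 6 (by decide), hf₁.fld 6 (by decide)]
    have h8 : s₂.nat 8 0 = s'.nat 8 0 := by rw [hf₂.nat 8 (by decide), hf₁.nat 8 (by decide)]
    have h11 : s₂.nat 11 0 = i := by
      rw [hf₂.nat 11 (by decide), hf₁.nat 11 (by decide), hv]
    refine Halts.ite (fun ht => Halts.seq (R := fun s' => s'.fld 6 0 = s₂.fld 5 0) (.setFld ?_)
      fun s₃ hf₃ h₃ => .setNat ⟨?_, ?_⟩) fun ht => .skip ⟨?_, ?_⟩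
    · simp [FldExpr.eval, FldExpr.var, NatExpr.eval]
    · simp [NatExpr.eval, NatExpr.var, h₃, h₂, hf₃.nat 11 (by decide), h11]
    · intro y hy
      simp only [Test.holds, FldExpr.eval, FldExpr.var, NatExpr.eval] at ht
      rw [State.setNat_fld, h₃]
      rcases Nat.lt_succ_iff_lt_or_eq.1 hy with hy | rfl
      · exact (ht.trans h6.le).trans (hinv₂ y hy)
      · exact h₂.le
    · rw [h6, h8, hinv₁]
    · intro y hy
      simp only [Test.holds, FldExpr.eval, FldExpr.var, NatExpr.eval] at ht
      rcases Nat.lt_succ_iff_lt_or_eq.1 hy with hy | rfl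
      · exact h6.le.trans (hinv₂ y hy)
      · exact (not_le.1 ht).le.trans h₂.le
  have hs₅ := hs₄.frame hf₅ (by decide) (by decide)
  have hC₅ := hC₄.frame hf₅ (by decide) (by decide)
  refine Halts.seq (R := fun s' => s'.nat 7 0 = s₅.nat 8 0) (.setNat ?_) fun s₆ hf₆ h₆ => ?_
  · simp [NatExpr.eval, NatExpr.var]
  have hs₆ := hs₅.frame hf₆ (by decide) (by decide)
  have hC₆ := hC₅.frame hf₆ (by decide) (by decide)
  refine ((halts_commitCenter hs₆ hC₆).mono_exp (by omega)).imp fun s' _ h => ⟨_, h, ?_⟩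
  intro y hy
  rw [h₆, ← h₅.1]
  exact h₅.2 y hy

variable [IsStrictOrderedRing K]

lemma halts_fillStep (hs : S.Agrees s) (hC : S.Current C s) :
    Halts S.B 1 fillStep s (fun s' => ∃ j < S.n, S.Current (insert (S.best j) C) s' ∧
      ∀ i < S.n, S.excess C i ≤ S.excess C j) := by
  refine Halts.seq (R := fun s' => s'.nat 17 0 = 0) (.setNat ?_) fun s₁ hf₁ h₁ => ?_
  · simp [NatExpr.eval]
  have hs₁ := hs.frame hf₁ (by decide) (by decide)
  have hC₁ := hC.frame hf₁ (by decide) (by decide)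
  refine Halts.seq (Halts.forLoop (d := 0) (a := 1) (N := S.n) (fun i s' => s'.nat 17 0 < S.n ∧
      ∀ y < i, S.excess C y ≤ S.excess C (s'.nat 17 0))
    (by decide) S.n_le_pow ?_ (fun _ _ _ h => h) ⟨by rw [h₁]; exact S.n_pos, by simp⟩ ?_)
    fun s₂ hf₂ h₂ => ?_
  · intro s' hf
    rw [NatExpr.eval, NatExpr.eval, hf.nat 0 (by decide), hs₁.n]
  · rintro i hi s' hf hv ⟨hinv₁, hinv₂⟩
    have hs' := hs₁.frame hf (by decide) (by decide)
    have hC' := hC₁.frame hf (by decide) (by decide)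
    have hn : (0 : K) < S.n := by exact_mod_cast S.n_pos
    have htest : (Test.fldLe (.sub (.get 3 (.var 17)) (.get 2 (.var 17)))
        (.sub (.get 3 (.var 10)) (.get 2 (.var 10)))).holds s' ↔
          S.excess C (s'.nat 17 0) ≤ S.excess C i := by
      simp only [Test.holds, FldExpr.eval, NatExpr.eval, NatExpr.var, hv, hC'.dist i hi,
        hC'.dist _ hinv₁, hs'.low]
      -- The program compares unscaled differences; the factor `n > 0` does not affect the order.
      exact (mul_le_mul_iff_right₀ hn).symm
    refine Halts.ite (fun ht => .setNat ?_) fun ht => .skip ⟨hinv₁, fun y hy => ?_⟩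
    · rw [htest] at ht
      have : (s'.setNat 17 ((NatExpr.lit 0).eval s') ((NatExpr.var 10).eval s')).nat 17 0 = i := by
        simp [NatExpr.eval, NatExpr.var, hv]
      rw [this]
      refine ⟨hi, fun y hy => ?_⟩
      rcases Nat.lt_succ_iff_lt_or_eq.1 hy with hy | rfl
      · exact (hinv₂ y hy).trans ht
      · exact le_rfl
    · rw [htest] at ht
      rcases Nat.lt_succ_iff_lt_or_eq.1 hy with hy | rfl
      · exact hinv₂ y hy
      · exact (not_le.1 ht).le
  have hs₂ := hs₁.frame hf₂ (by decide) (by decide)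
  have hC₂ := hC₁.frame hf₂ (by decide) (by decide)
  refine Halts.seq (R := fun s' => s'.nat 7 0 = S.best (s₂.nat 17 0)) (.setNat ?_)
    fun s₃ hf₃ h₃ => ?_
  · simp [NatExpr.eval, NatExpr.var, hs₂.best]
  have hs₃ := hs₂.frame hf₃ (by decide) (by decide)
  have hC₃ := hC₂.frame hf₃ (by decide) (by decide)
  refine (halts_commitCenter hs₃ hC₃).imp fun s' _ h => ⟨_, h₂.1, h₃ ▸ h, h₂.2⟩

/-- `C` is a possible candidate for the cap `g`. -/
def Setup.Candidate (S : Setup K) (g : K) (C : Finset ℕ) : Prop :=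
  ∃ C₀, S.Greedy S.U g S.t C₀ ∧ S.Fill C₀ (S.n - (S.n - 2 * S.k)) C

lemma halts_computeCandidate (hs : S.Agrees s) :
    Halts S.B 5 computeCandidate s (fun s' => ∃ C, S.Candidate (s.fld 7 0) C ∧ S.Current C s') := by
  refine Halts.seq (R := S.HasDist 3 ∅) ?_ fun s₁ hf₁ h₁ => ?_
  · refine ((Halts.forLoop (d := 0) (a := 1) (N := S.n) (fun i s' => ∀ j < i, s'.fld 3 j = S.Z)
      (by decide) S.n_le_pow ?_ (fun _ _ _ h => h) (by simp) ?_).mono_exp (by omega)).imp ?_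
    · intro s' hf
      rw [NatExpr.eval, NatExpr.eval, hf.nat 0 (by decide), hs.n]
    · intro i hi s' hf hv hinv
      have hs' := hs.frame hf (by decide) (by decide)
      refine .setFld fun j hj => ?_
      simp only [FldExpr.eval, FldExpr.var, NatExpr.eval, NatExpr.var, hv, hs'.Z]
      rw [State.setFld_fld_self, Function.update_apply]
      split_ifs with h
      · rfl
      · exact hinv j (by omega)
    · intro s' _ h j hj
      rw [h j hj, S.dist_empty]
  have hs₁ := hs.frame hf₁ (by decide) (by decide)
  refine Halts.seq (R := fun s' => ∀ x < S.U, s'.nat 5 x = 0) ?_ fun s₂ hf₂ h₂ => ?_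
  · refine (Halts.forLoop (d := 0) (a := 1) (N := S.U) (fun i s' => ∀ j < i, s'.nat 5 j = 0)
      (by decide) S.U_le_pow ?_ (by exact fun _ _ _ h => h) (by simp) ?_).mono_exp (by omega)
    · intro s' hf
      rw [NatExpr.eval, NatExpr.eval, hf.nat 0 (by decide), hs₁.U]
    · intro i hi s' hf hv hinv
      refine .setNat fun j hj => ?_
      simp only [NatExpr.eval, NatExpr.var, hv]
      rw [State.setNat_nat_self, Function.update_apply]
      split_ifs with h
      · rfl
      · exact hinv j (by omega)
  have hs₂ := hs₁.frame hf₂ (by decide) (by decide)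
  have hC₂ : S.Current ∅ s₂ := ⟨fun j hj => by rw [hf₂.fld 3 (by decide), h₁ j hj],
    fun x hx => by simp [h₂ x hx]⟩
  have hg₂ := (hf₂.fld 7 (by decide)).trans (hf₁.fld 7 (by decide))
  refine Halts.seq (Halts.forLoop (d := 2) (a := 3) (N := S.t) (fun i s' =>
    ∃ C, S.Greedy S.U (s.fld 7 0) i C ∧ S.Current C s') (by decide) S.t_le ?_
    (by exact fun _ _ _ ⟨C, h, h'⟩ => ⟨C, h, h'.dist, h'.mem⟩) ⟨∅, .zero, hC₂⟩ ?_) fun s₃ hf₃ h₃ => ?_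
  · intro s' hf
    rw [NatExpr.var, NatExpr.eval, NatExpr.eval, hf.nat 6 (by decide), hs₂.t]
  · rintro i hi s' hf hv ⟨C, hgr, hC⟩
    refine (halts_greedyStep (hs₂.frame hf (by decide) (by decide)) hC).imp ?_
    rintro s'' - ⟨x, hx, hmin⟩
    rw [hf.fld 7 (by decide), hg₂] at hmin
    exact ⟨_, hgr.step hmin, hx⟩
  have hs₃ := hs₂.frame hf₃ (by decide) (by decide)
  obtain ⟨C₀, hgr, hC₃⟩ := h₃
  refine ((Halts.forLoop (d := 1) (a := 1) (N := S.n - (S.n - 2 * S.k)) (fun i s' =>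
    ∃ C, S.Fill C₀ i C ∧ S.Current C s') (by decide) ((Nat.sub_le _ _).trans S.n_le_pow) ?_
    (by exact fun _ _ _ ⟨C, h, h'⟩ => ⟨C, h, h'.dist, h'.mem⟩) ⟨C₀, .zero, hC₃⟩ ?_).mono_exp
      (by omega)).imp ?_
  · intro s' hf
    simp only [NatExpr.eval, hf.nat 0 (by decide), hs₃.n, hs₃.k, two_mul]
  · rintro i hi s' hf hv ⟨C, hfill, hC⟩
    refine (halts_fillStep (hs₃.frame hf (by decide) (by decide)) hC).imp ?_
    rintro s'' - ⟨j, hj, hx, hmax⟩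
    exact ⟨_, hfill.step hj hmax, hx⟩
  · rintro s' - ⟨C, hfill, hC⟩
    exact ⟨C, ⟨C₀, hgr, hfill⟩, hC⟩

/-- The output is `C`, and its cost is stored. -/
structure Setup.Kept (S : Setup K) (C : Finset ℕ) (s : State K) : Prop where
  total : s.fld 9 0 = S.total C
  mem : ∀ x < S.U, s.nat 3 x ≠ 0 ↔ x ∈ C

omit [IsStrictOrderedRing K] in
lemma Setup.Kept.frame {s' : State K} (hC : S.Kept C s) {p : Prog} (h : Frame p s s')
    (h₁ : 3 ∉ p.natMods) (h₂ : 9 ∉ p.fldMods) : S.Kept C s' :=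
  ⟨by rw [h.fld 9 h₂, hC.total], fun x hx => by rw [h.nat 3 h₁, hC.mem x hx]⟩

omit [IsStrictOrderedRing K] in
lemma halts_keepBest {D : Finset ℕ} (hs : S.Agrees s) (hC : S.Current C s) (hD : S.Kept D s) :
    Halts S.B 1 keepBest s (fun s' => (S.total C ≤ S.total D ∧ S.Kept C s') ∨
      (S.total D ≤ S.total C ∧ S.Kept D s')) := by
  refine Halts.seq (R := fun s' => s'.fld 5 0 = 0) (.setFld ?_) fun s₁ hf₁ h₁ => ?_
  · simp [FldExpr.eval, NatExpr.eval]
  have hs₁ := hs.frame hf₁ (by decide) (by decide)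
  have hC₁ := hC.frame hf₁ (by decide) (by decide)
  refine Halts.seq (Halts.forLoop (d := 0) (a := 1) (N := S.n) (fun i s' => s'.fld 5 0 =
    ∑ j ∈ Finset.range i, S.dist C j) (by decide) S.n_le_pow ?_ (fun _ _ _ h => h)
    (by simpa using h₁) ?_) fun s₂ hf₂ h₂ => ?_
  · intro s' hf
    rw [NatExpr.eval, NatExpr.eval, hf.nat 0 (by decide), hs₁.n]
  · intro i hi s' hf hv hinv
    have hC' := hC₁.frame hf (by decide) (by decide)
    refine .setFld ?_
    simp [FldExpr.eval, FldExpr.var, NatExpr.eval, NatExpr.var, hv, hC'.dist i hi, hinv,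
      Finset.sum_range_succ]
  have hs₂ := hs₁.frame hf₂ (by decide) (by decide)
  have hC₂ := hC₁.frame hf₂ (by decide) (by decide)
  have hD₂ := (hD.frame hf₁ (by decide) (by decide)).frame hf₂ (by decide) (by decide)
  have htest : (Test.fldLe (.var 5) (.var 9)).holds s₂ ↔ S.total C ≤ S.total D := by
    simp only [Test.holds, FldExpr.eval, FldExpr.var, NatExpr.eval, h₂, hD₂.total]
    rfl
  refine Halts.ite (fun ht => ?_) fun ht => .skip (Or.inr ⟨?_, hD₂⟩)
  · rw [htest] at ht
    refine Halts.seq (R := fun s' => s'.fld 9 0 = S.total C) (.setFld ?_) fun s₃ hf₃ h₃ => ?_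
    · simpa [FldExpr.eval, FldExpr.var, NatExpr.eval, CostMatrix.total] using h₂
    have hs₃ := hs₂.frame hf₃ (by decide) (by decide)
    have hC₃ := hC₂.frame hf₃ (by decide) (by decide)
    refine (Halts.forLoop (d := 0) (a := 1) (N := S.U) (fun i s' => ∀ x < i, s'.nat 3 x = s₃.nat 5 x)
      (by decide) S.U_le_pow ?_ (by exact fun _ _ _ h => h) (by simp) ?_).imp ?_
    · intro s' hf
      rw [NatExpr.eval, NatExpr.eval, hf.nat 0 (by decide), hs₃.U]
    · intro i hi s' hf hv hinv
      refine .setNat fun j hj => ?_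
      simp only [NatExpr.eval, NatExpr.var, hv, hf.nat 5 (by decide)]
      rw [State.setNat_nat_self, Function.update_apply]
      split_ifs with h
      · rw [h]
      · exact hinv j (by omega)
    · intro s' hf h
      exact Or.inl ⟨ht, by rw [hf.fld 9 (by decide), h₃], fun x hx => by
        rw [h x hx, hC₃.mem x hx]⟩
  · rw [htest] at ht
    exact (not_le.1 ht).le

/-- The output has at most `t + 2 k` elements, and it is as good as some candidate for every
cap in `G`. -/
def Setup.Done (S : Setup K) (G : K → Prop) (s : State K) : Prop :=
  ∃ C, C.card ≤ S.t + (S.n - (S.n - 2 * S.k)) ∧ S.Kept C s ∧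
    ∀ g, G g → ∃ C', S.Candidate g C' ∧ S.total C ≤ S.total C'

omit [IsStrictOrderedRing K] in
lemma Setup.Done.mono {G G' : K → Prop} (h : S.Done G s) (hG : ∀ g, G' g → G g) : S.Done G' s := by
  obtain ⟨C, hcard, hkept, hC⟩ := h
  exact ⟨C, hcard, hkept, fun g hg => hC g (hG g hg)⟩

omit [IsStrictOrderedRing K] in
lemma Setup.Done.frame {s' : State K} {G : K → Prop} (hD : S.Done G s) {p : Prog} (h : Frame p s s')
    (h₁ : 3 ∉ p.natMods) (h₂ : 9 ∉ p.fldMods) : S.Done G s' := by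
  obtain ⟨C, hcard, hkept, hC⟩ := hD
  exact ⟨C, hcard, hkept.frame h h₁ h₂, hC⟩

/-- Keeping the cheaper of the old output and the new candidate preserves all earlier comparisons
and adds one for the current cap. -/
lemma halts_tryCap {G : K → Prop} (hs : S.Agrees s) (hG : S.Done G s) :
    Halts S.B 5 (.seq computeCandidate keepBest) s
      (S.Done fun g => G g ∨ g = s.fld 7 0) := by
  refine Halts.seq (halts_computeCandidate hs) fun s₁ hf₁ h₁ => ?_
  obtain ⟨C, hcand, hC⟩ := h₁
  obtain ⟨D, hcard, hkept, hD⟩ := hG.frame hf₁ (by decide) (by decide)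
  refine ((halts_keepBest (hs.frame hf₁ (by decide) (by decide)) hC hkept).mono_exp
    (by omega)).imp ?_
  rintro s' - (⟨hle, hkept'⟩ | ⟨hle, hkept'⟩)
  · refine ⟨C, ?_, hkept', ?_⟩
    · obtain ⟨C₀, hgr, hfill⟩ := hcand
      exact hfill.card_le.trans (Nat.add_le_add_right hgr.card_le _)
    · rintro g (hg | rfl)
      · obtain ⟨C', hC', hle'⟩ := hD g hg
        exact ⟨C', hC', hle.trans hle'⟩
      · exact ⟨C, hcand, le_rfl⟩
  · refine ⟨D, hcard, hkept', ?_⟩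
    rintro g (hg | rfl)
    · exact hD g hg
    · exact ⟨C, hcand, hle⟩

/-- The units of the caps. -/
def Setup.unit (S : Setup K) (e : ℕ) : K := if e < S.m then S.cost e - S.low (S.cust e) else 1

lemma halts_search (hs : S.Agrees s) (h : S.Done (fun _ => False) s) :
    Halts S.B 8 search s (S.Done fun g => ∃ e ≤ S.m, ∃ r : ℕ, 1 ≤ r ∧
      r ≤ (S.n + 1) * (S.n + 1) ∧ g = r * S.unit e) := by
  have hnpow : S.n + 1 ≤ (S.B + 1) ^ 1 := by
    have := S.n_le
    simp only [pow_one]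
    omega
  refine (Halts.forLoop (d := 7) (a := 1) (N := S.m + 1) (fun i s' => S.Done (fun g =>
    ∃ e < i, ∃ r : ℕ, 1 ≤ r ∧ r ≤ (S.n + 1) * (S.n + 1) ∧ g = r * S.unit e) s')
    (by decide) ?_ ?_ (by exact fun _ _ _ ⟨C, h, h', h''⟩ => ⟨C, h, ⟨h'.total, h'.mem⟩, h''⟩)
    (h.mono fun g => by simp) ?_).imp ?_
  · have := S.m_le
    simp only [pow_one]
    omega
  · intro s' hf
    simp [NatExpr.eval, hf.nat 0 (by decide), hs.m]
  · intro e he s' hf hv hinv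
    have hs' := hs.frame hf (by decide) (by decide)
    refine Halts.seq (R := fun s' => s'.fld 8 0 = S.unit e) ?_ fun s₁ hf₁ h₁ => ?_
    · refine Halts.ite (fun ht => .setFld ?_) fun ht => .setFld ?_
      · simp only [Test.holds, NatExpr.eval, NatExpr.var, hv, hs'.m] at ht
        have : e < S.m := by omega
        simp [FldExpr.eval, NatExpr.eval, NatExpr.var, hv, hs'.cost, hs'.low, hs'.cust,
          Setup.unit, this]
      · simp only [Test.holds, NatExpr.eval, NatExpr.var, hv, hs'.m] at ht
        have : ¬ e < S.m := by omega
        simp [FldExpr.eval, NatExpr.eval, Setup.unit, this]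
    have hs₁ := hs'.frame hf₁ (by decide) (by decide)
    have hD₁ := hinv.frame hf₁ (by decide) (by decide)
    refine Halts.seq (R := fun s' => s'.fld 7 0 = 0) (.setFld ?_) fun s₂ hf₂ h₂ => ?_
    · simp [FldExpr.eval, NatExpr.eval]
    have hs₂ := hs₁.frame hf₂ (by decide) (by decide)
    have hD₂ := hD₁.frame hf₂ (by decide) (by decide)
    have h8₂ := (congrFun (hf₂.fld 8 (by decide)) 0).trans h₁
    refine (Halts.forLoop (d := 6) (a := 1) (N := S.n + 1) (fun i s' =>
      s'.fld 7 0 = (i * (S.n + 1) : ℕ) * S.unit e ∧ S.Done (fun g =>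
        (∃ e' < e, ∃ r : ℕ, 1 ≤ r ∧ r ≤ (S.n + 1) * (S.n + 1) ∧ g = r * S.unit e') ∨
          ∃ r : ℕ, 1 ≤ r ∧ r ≤ i * (S.n + 1) ∧ g = r * S.unit e) s')
      (by decide) hnpow ?_ (by exact fun _ _ _ ⟨h₀, C, h, h', h''⟩ => ⟨h₀, C, h, ⟨h'.total, h'.mem⟩, h''⟩)
      ⟨by simp [h₂], hD₂.mono ?_⟩ ?_).imp ?_
    · intro s' hf
      simp [NatExpr.eval, hf.nat 0 (by decide), hs₂.n]
    · rintro g (hg | ⟨r, h1, h2, -⟩)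
      · exact hg
      · omega
    · rintro i hi s' hf hv ⟨hinv₁, hinv₂⟩
      have hs' := hs₂.frame hf (by decide) (by decide)
      have h8' := (congrFun (hf.fld 8 (by decide)) 0).trans h8₂
      refine (Halts.forLoop (d := 5) (a := 1) (N := S.n + 1) (fun l s' =>
        s'.fld 7 0 = (i * (S.n + 1) + l : ℕ) * S.unit e ∧ S.Done (fun g =>
          (∃ e' < e, ∃ r : ℕ, 1 ≤ r ∧ r ≤ (S.n + 1) * (S.n + 1) ∧ g = r * S.unit e') ∨
            ∃ r : ℕ, 1 ≤ r ∧ r ≤ i * (S.n + 1) + l ∧ g = r * S.unit e) s')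
        (by decide) hnpow ?_
        (by exact fun _ _ _ ⟨h₀, C, h, h', h''⟩ => ⟨h₀, C, h, ⟨h'.total, h'.mem⟩, h''⟩)
        ⟨hinv₁, hinv₂⟩ ?_).imp ?_
      · intro s' hf
        simp [NatExpr.eval, hf.nat 0 (by decide), hs'.n]
      · rintro l hl s'' hf hv ⟨hinv₁, hinv₂⟩
        have hs'' := hs'.frame hf (by decide) (by decide)
        have h8'' := (congrFun (hf.fld 8 (by decide)) 0).trans h8'
        refine Halts.seq (R := fun s' => s'.fld 7 0 = (i * (S.n + 1) + (l + 1) : ℕ) * S.unit e)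
          (.setFld ?_) fun s₃ hf₃ h₃ => ?_
        · simp [FldExpr.eval, FldExpr.var, NatExpr.eval, hinv₁, h8'']
          ring
        refine (halts_tryCap (hs''.frame hf₃ (by decide) (by decide))
          (hinv₂.frame hf₃ (by decide) (by decide))).imp fun s₄ hf₄ h₄ => ⟨?_, h₄.mono ?_⟩
        · rw [hf₄.fld 7 (by decide), h₃]
        · rintro g (hg | ⟨r, hr, hr', rfl⟩)
          · exact Or.inl (Or.inl hg)
          -- Either the multiple was treated before, or it is the cap just tried.
          · rcases hr'.lt_or_eq with hlt | rfl
            · exact Or.inl (Or.inr ⟨r, hr, by omega, rfl⟩)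
            · exact Or.inr h₃.symm
      · rintro s'' - ⟨h1, h2⟩
        have : i * (S.n + 1) + (S.n + 1) = (i + 1) * (S.n + 1) := by ring
        rw [this] at h1 h2
        exact ⟨h1, h2⟩
    · rintro s'' - ⟨-, h2⟩
      refine h2.mono ?_
      rintro g ⟨e', he', r, hr⟩
      rcases Nat.lt_succ_iff_lt_or_eq.1 he' with he' | rfl
      · exact Or.inl ⟨e', he', r, hr⟩
      · exact Or.inr ⟨r, hr⟩
  · intro s' _ h
    exact h.mono fun g ⟨e, he, hr⟩ => ⟨e, Nat.lt_succ_of_le he, hr⟩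

end KMedian

namespace KMedian

open FieldRAM

/-! ### Preprocessing: the value of a non-edge and the cheapest centers -/

section Prepare

variable {K : Type} [Field K] [LinearOrder K] {s : State K} {B n m : ℕ}

lemma halts_prepare (hn : s.nat 0 1 = n) (hm : s.nat 0 2 = m) (hnB : n ≤ B) (hmB : m ≤ B)
    (hcost : ∀ e < m, s.fld 0 e ≤ 1 + ∑ e ∈ Finset.range m, s.fld 0 e) :
    Halts B 1 prepare s (fun s' => s'.fld 1 0 = 1 + ∑ e ∈ Finset.range m, s.fld 0 e ∧
      s'.fld 9 0 = n * (1 + ∑ e ∈ Finset.range m, s.fld 0 e) ∧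
      ∀ j < n, (∀ e < m, s.nat 2 e = j → s'.fld 2 j ≤ s.fld 0 e) ∧
        ((s'.fld 2 j = 1 + ∑ e ∈ Finset.range m, s.fld 0 e ∧ ∀ e < m, s.nat 2 e ≠ j) ∨
        ∃ e < m, s.nat 2 e = j ∧ s.nat 1 e = s'.nat 4 j ∧ s.fld 0 e = s'.fld 2 j)) := by
  set Z := 1 + ∑ e ∈ Finset.range m, s.fld 0 e with hZ
  have hnB' : n ≤ (B + 1) ^ 1 := by simp only [pow_one]; omega
  have hmB' : m ≤ (B + 1) ^ 1 := by simp only [pow_one]; omega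
  refine Halts.seq (R := fun s' => s'.fld 1 0 = 1) (.setFld ?_) fun s₁ hf₁ h₁ => ?_
  · simp [FldExpr.eval, NatExpr.eval]
  refine Halts.seq (Halts.forLoop (d := 0) (a := 1) (N := m) (fun i s' => s'.fld 1 0 =
    1 + ∑ e ∈ Finset.range i, s.fld 0 e) (by decide) hmB' ?_ (by exact fun _ _ _ h => h)
    (by simpa using h₁) ?_) fun s₂ hf₂ h₂ => ?_
  · intro s' hf
    rw [NatExpr.eval, NatExpr.eval, hf.nat 0 (by decide), hf₁.nat 0 (by decide), hm]
  · intro i hi s' hf hv hinv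
    refine .setFld ?_
    simp [FldExpr.eval, FldExpr.var, NatExpr.eval, NatExpr.var, hv, hinv, Finset.sum_range_succ,
      hf.fld 0 (by decide), hf₁.fld 0 (by decide), add_assoc]
  have hf₂ : s₂.nat 0 = s.nat 0 ∧ s₂.nat 1 = s.nat 1 ∧ s₂.nat 2 = s.nat 2 ∧ s₂.fld 0 = s.fld 0 :=
    ⟨by rw [hf₂.nat 0 (by decide), hf₁.nat 0 (by decide)],
      by rw [hf₂.nat 1 (by decide), hf₁.nat 1 (by decide)],
      by rw [hf₂.nat 2 (by decide), hf₁.nat 2 (by decide)],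
      by rw [hf₂.fld 0 (by decide), hf₁.fld 0 (by decide)]⟩
  refine Halts.seq (Halts.forLoop (d := 0) (a := 1) (N := n) (fun i s' => ∀ j < i, s'.fld 2 j = Z)
    (by decide) hnB' ?_ (by exact fun _ _ _ h => h) (by simp) ?_) fun s₃ hf₃ h₃ => ?_
  · intro s' hf
    rw [NatExpr.eval, NatExpr.eval, hf.nat 0 (by decide), hf₂.1, hn]
  · intro i hi s' hf hv hinv
    refine .setFld fun j hj => ?_
    simp only [FldExpr.eval, FldExpr.var, NatExpr.eval, NatExpr.var, hv, hf.fld 1 (by decide), h₂]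
    rw [State.setFld_fld_self, Function.update_apply]
    split_ifs with h
    · rfl
    · exact hinv j (by omega)
  have h1₃ := (congrFun (hf₃.fld 1 (by decide)) 0).trans h₂
  have hf₃ : s₃.nat 0 = s.nat 0 ∧ s₃.nat 1 = s.nat 1 ∧ s₃.nat 2 = s.nat 2 ∧ s₃.fld 0 = s.fld 0 :=
    ⟨by rw [hf₃.nat 0 (by decide), hf₂.1], by rw [hf₃.nat 1 (by decide), hf₂.2.1],
      by rw [hf₃.nat 2 (by decide), hf₂.2.2.1], by rw [hf₃.fld 0 (by decide), hf₂.2.2.2]⟩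
  refine Halts.seq (Halts.forLoop (d := 0) (a := 1) (N := m) (fun i s' => ∀ j < n,
      (∀ e < i, s.nat 2 e = j → s'.fld 2 j ≤ s.fld 0 e) ∧
        ((s'.fld 2 j = Z ∧ ∀ e < i, s.nat 2 e ≠ j) ∨
        ∃ e < i, s.nat 2 e = j ∧ s.nat 1 e = s'.nat 4 j ∧ s.fld 0 e = s'.fld 2 j))
    (by decide) hmB' ?_ (by exact fun _ _ _ h => h) ?_ ?_) fun s₄ hf₄ h₄ => ?_
  · intro s' hf
    rw [NatExpr.eval, NatExpr.eval, hf.nat 0 (by decide), hf₃.1, hm]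
  · intro j hj
    simp [h₃ j hj]
  · intro i hi s' hf hv hinv
    have hn1 : s'.nat 1 = s.nat 1 := by rw [hf.nat 1 (by decide), hf₃.2.1]
    have hn2 : s'.nat 2 = s.nat 2 := by rw [hf.nat 2 (by decide), hf₃.2.2.1]
    have hf0 : s'.fld 0 = s.fld 0 := by rw [hf.fld 0 (by decide), hf₃.2.2.2]
    refine Halts.ite (fun ht => Halts.seq (R := fun s'' => s'' =
      s'.setFld 2 (s.nat 2 i) (s.fld 0 i)) (.setFld ?_) fun s'' _ h'' => .setNat ?_) fun ht =>
      .skip ?_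
    · simp only [FldExpr.eval, NatExpr.eval, NatExpr.var, hv, hn2, hf0]
    · simp only [Test.holds, FldExpr.eval, NatExpr.eval, NatExpr.var, hv, hn2, hf0] at ht
      have e1 : s''.nat 9 0 = i := by rw [h'', State.setFld_nat, hv]
      have e2 : s''.nat 2 = s.nat 2 := by rw [h'', State.setFld_nat, hn2]
      have e3 : s''.nat 1 = s.nat 1 := by rw [h'', State.setFld_nat, hn1]
      have e4 : s''.nat 4 = s'.nat 4 := by rw [h'', State.setFld_nat]
      have e5 : s''.fld 2 = Function.update (s'.fld 2) (s.nat 2 i) (s.fld 0 i) := by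
        rw [h'', State.setFld_fld_self]
      intro j hj
      simp only [NatExpr.eval, NatExpr.var, e1, e2, e3, State.setNat_fld, State.setNat_nat_self,
        e4, e5]
      obtain ⟨hle, hor⟩ := hinv j hj
      by_cases hij : j = s.nat 2 i
      · subst hij
        simp only [Function.update_self]
        refine ⟨fun e he hej => ?_, Or.inr ⟨i, by omega, rfl, rfl, rfl⟩⟩
        rcases Nat.lt_succ_iff_lt_or_eq.1 he with he | rfl
        · exact ht.trans (hle e he hej)
        · exact le_rfl
      · simp only [Function.update_of_ne hij]
        refine ⟨fun e he hej => ?_, ?_⟩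
        · rcases Nat.lt_succ_iff_lt_or_eq.1 he with he | rfl
          · exact hle e he hej
          · exact absurd hej.symm hij
        · rcases hor with ⟨h1, h2⟩ | ⟨e, he, h⟩
          · refine Or.inl ⟨h1, fun e he hej => ?_⟩
            rcases Nat.lt_succ_iff_lt_or_eq.1 he with he | rfl
            · exact h2 e he hej
            · exact hij hej.symm
          · exact Or.inr ⟨e, by omega, h⟩
    · simp only [Test.holds, FldExpr.eval, NatExpr.eval, NatExpr.var, hv, hn2, hf0] at ht
      intro j hj
      obtain ⟨hle, hor⟩ := hinv j hj
      refine ⟨fun e he hej => ?_, ?_⟩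
      · rcases Nat.lt_succ_iff_lt_or_eq.1 he with he | rfl
        · exact hle e he hej
        · exact hej ▸ (not_le.1 ht).le
      · rcases hor with ⟨h1, h2⟩ | ⟨e, he, h⟩
        · refine Or.inl ⟨h1, fun e he hej => ?_⟩
          rcases Nat.lt_succ_iff_lt_or_eq.1 he with he | rfl
          · exact h2 e he hej
          -- The first edge of a customer always passes the test, since its cost is at most the
          -- default `Z`; thus a customer still at the default has no edge so far.
          · rw [hej, h1] at ht
            exact ht (hcost e hi)
        · exact Or.inr ⟨e, by omega, h⟩
  refine .setFld ?_
  have h1₄ := (congrFun (hf₄.fld 1 (by decide)) 0).trans h1₃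
  have h0₄ : s₄.nat 0 1 = n := by rw [hf₄.nat 0 (by decide), hf₃.1, hn]
  refine ⟨?_, ?_, ?_⟩
  · simpa using h1₄
  · simp [FldExpr.eval, FldExpr.var, NatExpr.eval, h1₄, h0₄, ← hZ]
  · intro j hj
    simpa using h₄ j hj

end Prepare

/-! ### The number of greedy steps -/

/-- From `(1 - 1/k)^i ≤ exp(-i/k)` the hypothesis gives `exp(i/k) < n²/(2k(2k+1))`; take logarithms.
So while the loop that counts the steps continues, the count is still below `T`. -/
lemma lt_kMedianT {k n i : ℕ} (hk : 1 ≤ k)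
    (h : 2 * k * (2 * k + 1) * k ^ i < n ^ 2 * (k - 1) ^ i) : (i : ℤ) < kMedianT k n := by
  have hk0 : (0 : ℝ) < k := by exact_mod_cast hk
  have hw : (0 : ℝ) < 2 * k * (2 * k + 1) := by positivity
  have h' : 2 * k * (2 * k + 1) * (k : ℝ) ^ i < n ^ 2 * (k - 1) ^ i := by
    have := (Nat.cast_lt (α := ℝ)).2 h
    push_cast [Nat.cast_sub hk] at this
    exact this
  rw [kMedianT, Int.lt_ceil, Int.cast_natCast]
  have hk1 : (0 : ℝ) ≤ 1 - 1 / k := by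
    rw [sub_nonneg, div_le_one hk0]
    exact_mod_cast hk
  have hexp : (1 - 1 / (k : ℝ)) ^ i ≤ Real.exp (-(i / k)) := by
    calc (1 - 1 / (k : ℝ)) ^ i ≤ Real.exp (-(1 / k)) ^ i :=
          pow_le_pow_left₀ hk1 (Real.one_sub_le_exp_neg _) i
      _ = Real.exp (-(i / k)) := by rw [← Real.exp_nat_mul]; congr 1; ring
  have hpow : ((k : ℝ) - 1) ^ i = k ^ i * (1 - 1 / (k : ℝ)) ^ i := by
    rw [← mul_pow]
    congr 1
    field_simp
  have hlt : Real.exp (i / k) < n ^ 2 / (2 * k * (2 * k + 1)) := by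
    rw [lt_div_iff₀ hw]
    rw [hpow] at h'
    have h2 : 2 * k * (2 * k + 1) * (k : ℝ) ^ i < n ^ 2 * Real.exp (-(i / k)) * k ^ i := by
      refine h'.trans_le ?_
      have := mul_le_mul_of_nonneg_left hexp (by positivity : (0 : ℝ) ≤ n ^ 2 * k ^ i)
      linarith
    have h3 := lt_of_mul_lt_mul_right h2 (by positivity)
    rw [Real.exp_neg, ← div_eq_mul_inv, lt_div_iff₀ (Real.exp_pos _)] at h3
    linarith
  have hlog := (Real.lt_log_iff_exp_lt ((Real.exp_pos _).trans hlt)).2 hlt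
  rw [div_lt_iff₀ hk0] at hlog
  linarith

lemma kMedianT_le {k n : ℕ} (hk : 1 ≤ k) (hn : 1 ≤ n) (hkn : k ≤ n) :
    (kMedianT k n).toNat ≤ n ^ 3 := by
  rw [Int.toNat_le, kMedianT, Int.ceil_le]
  have hk0 : (1 : ℝ) ≤ k := by exact_mod_cast hk
  have hn0 : (1 : ℝ) ≤ n := by exact_mod_cast hn
  have hkn' : (k : ℝ) ≤ n := by exact_mod_cast hkn
  have hw : (1 : ℝ) ≤ 2 * k * (2 * k + 1) := by nlinarith
  have h1 : Real.log ((n : ℝ) ^ 2 / (2 * k * (2 * k + 1))) ≤ n ^ 2 :=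
    (Real.log_le_self (by positivity)).trans (div_le_self (by positivity) hw)
  push_cast
  calc (k : ℝ) * Real.log ((n : ℝ) ^ 2 / (2 * k * (2 * k + 1))) ≤ k * n ^ 2 := by gcongr
    _ ≤ n * n ^ 2 := by gcongr
    _ = _ := by ring

/-- For `n ≥ 2k` the argument of the logarithm is at least `2k/(2k+1)`, so by `log x ≥ 1 - 1/x` the
number being rounded up is at least `-1/2`. -/
lemma kMedianT_nonneg {k n : ℕ} (hk : 1 ≤ k) (hkn : 2 * k ≤ n) : 0 ≤ kMedianT k n := by
  have hk0 : (1 : ℝ) ≤ k := by exact_mod_cast hk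
  have hkn' : 2 * (k : ℝ) ≤ n := by exact_mod_cast hkn
  have hsq : (2 * (k : ℝ)) ^ 2 ≤ n ^ 2 := by gcongr
  have hx : 2 * (k : ℝ) / (2 * k + 1) ≤ n ^ 2 / (2 * k * (2 * k + 1)) := by
    rw [div_le_div_iff₀ (by positivity) (by positivity)]
    nlinarith
  have hlog := Real.one_sub_inv_le_log_of_pos (show 0 < 2 * (k : ℝ) / (2 * k + 1) by positivity)
  have hmono := Real.log_le_log (by positivity) hx
  have : (1 : ℝ) - (2 * (k : ℝ) / (2 * k + 1))⁻¹ = -(1 / (2 * k)) := by field_simp; ring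
  rw [this] at hlog
  have h1 : (k : ℝ) * (-(1 / (2 * k))) ≤
      k * Real.log (n ^ 2 / (2 * k * (2 * k + 1))) := by
    gcongr
    exact hlog.trans hmono
  have h2 : (k : ℝ) * (-(1 / (2 * k))) = -(1 / 2) := by field_simp
  have : (-1 : ℤ) < kMedianT k n := by
    rw [kMedianT, Int.lt_ceil]
    push_cast
    linarith
  omega

/-- This amounts to `exp 2 > 6`. It matters because for `k = n = 1` the budget is `T + 2`, and the
single filling step needs one center. -/
lemma neg_one_le_kMedianT_one : -1 ≤ kMedianT 1 1 := by
  have : (-2 : ℤ) < kMedianT 1 1 := by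
    rw [kMedianT, Int.lt_ceil]
    push_cast
    rw [one_mul, Real.lt_log_iff_exp_lt (by norm_num), Real.exp_neg]
    have h := Real.exp_one_gt_d9
    have h2 : Real.exp 2 = Real.exp 1 * Real.exp 1 := by rw [← Real.exp_add]; norm_num
    rw [inv_lt_comm₀ (Real.exp_pos _) (by norm_num), h2]
    norm_num
    nlinarith
  omega

/-- The only admissible case with `n < 2k` is `k = n = 1`, where `T` can be negative but only
`min(n, 2k) = 1` center is filled in. -/
lemma size_le_kMedianAlpha {k n t : ℕ} (hk : 1 ≤ k) (hn : 1 ≤ n) (hkn : k = 1 ∨ 2 * k ≤ n)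
    (ht : (t : ℤ) ≤ kMedianT k n ∨ t = 0) :
    ((t + (n - (n - 2 * k)) : ℕ) : ℝ) ≤ kMedianAlpha k n * k := by
  have hk0 : (0 : ℝ) < k := by exact_mod_cast hk
  have h : ((t + (n - (n - 2 * k)) : ℕ) : ℤ) ≤ kMedianT k n + 2 * k := by
    rcases le_or_gt (2 * k) n with h2 | h2
    · have := kMedianT_nonneg hk h2
      omega
    · obtain rfl : k = 1 := by omega
      obtain rfl : n = 1 := by omega
      have := neg_one_le_kMedianT_one
      omega
  have h' : (((t + (n - (n - 2 * k)) : ℕ) : ℤ) : ℝ) ≤ ((kMedianT k n + 2 * k : ℤ) : ℝ) :=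
    Int.cast_le.2 h
  rw [Int.cast_natCast] at h'
  refine h'.trans (le_of_eq ?_)
  rw [kMedianAlpha]
  push_cast
  field_simp

lemma halts_countSteps {K : Type} [Field K] [LinearOrder K] [IsStrictOrderedRing K] {s : State K}
    {B n k : ℕ} (hn : s.nat 0 1 = n) (hk : s.nat 0 3 = k) (hnB : n ≤ B) (hk1 : 1 ≤ k)
    (hkn : k ≤ n) :
    Halts B 3 countSteps s (fun s' => ((s'.nat 6 0 : ℤ) ≤ kMedianT k n ∨ s'.nat 6 0 = 0) ∧
      (k - 1) ^ s'.nat 6 0 * n ^ 2 ≤ k ^ s'.nat 6 0 * (2 * k * (2 * k + 1))) := by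
  refine Halts.seq (R := fun s' => s'.nat 6 0 = 0) (.setNat ?_) fun s₁ hf₁ h₁ => ?_
  · simp [NatExpr.eval]
  refine Halts.seq (R := fun s' => s'.fld 10 0 = 1) (.setFld ?_) fun s₂ hf₂ h₂ => ?_
  · simp [NatExpr.eval, FldExpr.eval]
  refine Halts.seq (R := fun s' => s'.fld 11 0 = 1) (.setFld ?_) fun s₃ hf₃ h₃ => ?_
  · simp [NatExpr.eval, FldExpr.eval]
  have h0₃ : s₃.nat 0 = s.nat 0 := by
    rw [hf₃.nat 0 (by decide), hf₂.nat 0 (by decide), hf₁.nat 0 (by decide)]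
  have h6₃ : s₃.nat 6 0 = 0 := by rw [hf₃.nat 6 (by decide), hf₂.nat 6 (by decide), h₁]
  have h10₃ : s₃.fld 10 0 = 1 := by rw [hf₃.fld 10 (by decide), h₂]
  have htest : ∀ i (s' : State K), s'.nat 0 = s.nat 0 → s'.fld 10 0 = ((k - 1) ^ i : ℕ) →
      s'.fld 11 0 = (k ^ i : ℕ) → ((Test.fldLe
      (.add (.mul (.ofNat (.add (.get 0 (.lit 3)) (.get 0 (.lit 3)))) (.mul (.ofNat
        (.add (.add (.get 0 (.lit 3)) (.get 0 (.lit 3))) (.lit 1))) (.var 11))) (.ofNat (.lit 1)))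
      (.mul (.ofNat (.get 0 (.lit 1))) (.mul (.ofNat (.get 0 (.lit 1))) (.var 10)))).holds s' ↔
        2 * k * (2 * k + 1) * k ^ i < n ^ 2 * (k - 1) ^ i) := by
    intro i s' h0 h10 h11
    simp only [Test.holds, FldExpr.eval, FldExpr.var, NatExpr.eval, h0, hn, hk, h10, h11]
    rw [← Nat.cast_mul, ← Nat.cast_mul, ← Nat.cast_add, ← Nat.cast_mul, ← Nat.cast_mul,
      Nat.cast_le, Nat.add_one_le_iff]
    ring_nf
  refine (Halts.loop (B := B) (d := 0) (a := 3) (N := (kMedianT k n).toNat)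
    (fun i (s' : State K) => s'.nat 6 0 = i ∧
    s'.fld 10 0 = ((k - 1) ^ i : ℕ) ∧ s'.fld 11 0 = (k ^ i : ℕ) ∧
      ((i : ℤ) ≤ kMedianT k n ∨ i = 0)) ⟨h6₃, by simpa using h10₃, by simpa using h₃, Or.inr rfl⟩
      ?_ ((kMedianT_le hk1 (by omega) hkn).trans (Nat.pow_le_pow_left (by omega) 3))).imp ?_
  · rintro i s' hf ⟨h6, h10, h11, -⟩ ht
    have h0 : s'.nat 0 = s.nat 0 := (hf.nat 0 (by decide)).trans h0₃
    rw [htest i s' h0 h10 h11] at ht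
    have hlt := lt_kMedianT hk1 ht
    refine ⟨by omega, ?_⟩
    refine Halts.seq (R := fun s' => s'.fld 10 0 = ((k - 1) ^ (i + 1) : ℕ)) (.setFld ?_)
      fun s₁ hf₁ h₁ => ?_
    · simp [FldExpr.eval, FldExpr.var, NatExpr.eval, h0, hk, h10, pow_succ']
    refine Halts.seq (R := fun s' => s'.fld 11 0 = (k ^ (i + 1) : ℕ)) (.setFld ?_)
      fun s₂ hf₂ h₂ => ?_
    · simp [FldExpr.eval, FldExpr.var, NatExpr.eval, hf₁.nat 0 (by decide), h0, hk,
        hf₁.fld 11 (by decide), h11, pow_succ']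
    refine .setNat ⟨?_, ?_, ?_, ?_⟩
    · simp [NatExpr.eval, NatExpr.var, hf₂.nat 6 (by decide), hf₁.nat 6 (by decide), h6]
    · rw [State.setNat_fld, hf₂.fld 10 (by decide), h₁]
    · rw [State.setNat_fld, h₂]
    · left
      push_cast
      omega
  · rintro s' hf ⟨i, -, ⟨h6, h10, h11, hi⟩, ht⟩
    rw [htest i s' ((hf.nat 0 (by decide)).trans h0₃) h10 h11] at ht
    rw [h6]
    refine ⟨hi, ?_⟩
    have := not_lt.1 ht
    linarith

end KMedian

namespace KMedian

open FieldRAM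

/-! ### The instance as a cost matrix -/

variable {K : Type} [Field K] [LinearOrder K]

/-- The costs, with the value `Z` for non-edges. -/
noncomputable def fullCost (I : KMedian K) (Z : K) (x j : ℕ) : K :=
  if h : ∃ p ∈ I.edges, (p.1 : ℕ) = x ∧ (p.2 : ℕ) = j then I.cost h.choose.1 h.choose.2 else Z

/-- A number above the costs of all feasible solutions. -/
def bigCost (I : KMedian K) : K := 1 + ∑ p ∈ I.edges, I.cost p.1 p.2

variable (I : KMedian K)

lemma fullCost_of_mem (Z : K) {p : Fin I.centers × Fin I.customers} (hp : p ∈ I.edges) :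
    I.fullCost Z p.1 p.2 = I.cost p.1 p.2 := by
  have h : ∃ q ∈ I.edges, (q.1 : ℕ) = p.1 ∧ (q.2 : ℕ) = p.2 := ⟨p, hp, rfl, rfl⟩
  rw [fullCost, dif_pos h]
  rw [Fin.ext h.choose_spec.2.1, Fin.ext h.choose_spec.2.2]

lemma fullCost_cases (Z : K) (x j : ℕ) :
    (∃ p ∈ I.edges, (p.1 : ℕ) = x ∧ (p.2 : ℕ) = j) ∨ I.fullCost Z x j = Z := by
  by_cases h : ∃ p ∈ I.edges, (p.1 : ℕ) = x ∧ (p.2 : ℕ) = j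
  · exact Or.inl h
  · exact Or.inr (dif_neg h)

variable [IsStrictOrderedRing K]

/-- The gap of `1` separates edges from non-edges and is the gap that the extra unit `1` of the caps
relies on. -/
lemma cost_add_one_le {p : Fin I.centers × Fin I.customers} (hp : p ∈ I.edges) :
    I.cost p.1 p.2 + 1 ≤ I.bigCost := by
  have := Finset.single_le_sum (f := fun p => I.cost p.1 p.2) I.cost_nonneg hp
  rw [bigCost]
  linarith

lemma fullCost_le (x j : ℕ) : I.fullCost I.bigCost x j ≤ I.bigCost := by
  rcases I.fullCost_cases I.bigCost x j with ⟨p, hp, rfl, rfl⟩ | h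
  · rw [I.fullCost_of_mem _ hp]
    linarith [I.cost_add_one_le hp]
  · exact h.le

lemma bigCost_pos : 0 < I.bigCost := by
  have := Finset.sum_nonneg I.cost_nonneg
  rw [bigCost]
  linarith

lemma fullCost_nonneg (x j : ℕ) : 0 ≤ I.fullCost I.bigCost x j := by
  rcases I.fullCost_cases I.bigCost x j with ⟨p, hp, rfl, rfl⟩ | h
  · rw [I.fullCost_of_mem _ hp]
    exact I.cost_nonneg p hp
  · rw [h]
    exact I.bigCost_pos.le

/-- The matrix `A` has the costs of the instance `I`. -/
structure Represents (A : CostMatrix K) : Prop where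
  n : A.n = I.customers
  c : A.c = I.fullCost I.bigCost
  Z : A.Z = I.bigCost

/-! ### From matrix costs back to costs with infinity -/

variable {I} {A : CostMatrix K} (hA : I.Represents A) {D : Finset (Fin I.centers)} {C : Finset ℕ}

include hA

omit [IsStrictOrderedRing K] in
lemma Represents.c_eq {p : Fin I.centers × Fin I.customers} (hp : p ∈ I.edges) :
    A.c p.1 p.2 = I.cost p.1 p.2 := by
  rw [hA.c, I.fullCost_of_mem _ hp]

omit [IsStrictOrderedRing K] in
lemma Represents.exists_edge {x j : ℕ} (h : A.c x j < A.Z) :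
    ∃ p ∈ I.edges, (p.1 : ℕ) = x ∧ (p.2 : ℕ) = j := by
  rw [hA.c, hA.Z] at h
  exact (I.fullCost_cases _ x j).resolve_right h.ne

lemma Represents.inf_eq (hCD : ∀ i : Fin I.centers, i ∈ D ↔ (i : ℕ) ∈ C) (j : Fin I.customers) :
    D.inf (fun i => I.assignCost i j) =
      if A.dist C j < A.Z then (A.dist C j : WithTop K) else ⊤ := by
  split_ifs with h
  · refine le_antisymm ?_ (Finset.le_inf fun i hi => ?_)
    · rcases A.dist_eq_Z_or C j with h' | ⟨x, hx, h'⟩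
      · exact absurd h' h.ne
      · rw [h'] at h ⊢
        obtain ⟨p, hp, rfl, hpj⟩ := hA.exists_edge h
        obtain rfl : p.2 = j := Fin.ext hpj
        refine (Finset.inf_le ((hCD _).2 hx)).trans ?_
        rw [assignCost, if_pos hp, hA.c_eq hp]
    · rw [assignCost]
      split_ifs with hp
      · rw [← hA.c_eq hp]
        exact WithTop.coe_le_coe.2 (A.dist_le ((hCD i).1 hi) j)
      · exact le_top
  · rw [eq_top_iff]
    refine Finset.le_inf fun i hi => ?_
    rw [assignCost, if_neg]
    intro hp
    refine h ((A.dist_le ((hCD i).1 hi) j).trans_lt ?_)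
    rw [hA.c_eq hp, hA.Z]
    linarith [I.cost_add_one_le hp]

lemma Represents.setCost_eq_top (hCD : ∀ i : Fin I.centers, i ∈ D ↔ (i : ℕ) ∈ C)
    {j : Fin I.customers} (hj : ¬ A.dist C j < A.Z) : I.setCost D = ⊤ := by
  rw [setCost, WithTop.sum_eq_top]
  exact ⟨j, Finset.mem_univ _, by rw [hA.inf_eq hCD, if_neg hj]⟩

lemma Represents.setCost_eq (hCD : ∀ i : Fin I.centers, i ∈ D ↔ (i : ℕ) ∈ C)
    (h : ∀ j < A.n, A.dist C j < A.Z) : I.setCost D = (A.total C : WithTop K) := by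
  rw [setCost, CostMatrix.total, hA.n, Finset.sum_range, WithTop.coe_sum]
  exact Finset.sum_congr rfl fun j _ => by
    rw [hA.inf_eq hCD, if_pos (h j (by rw [hA.n]; exact j.2))]

/-- Each customer pays for one of its own edges. Grouping the edges by customer bounds the total by
the sum of all edge costs, which is `Z - 1`. -/
lemma Represents.total_lt (h : ∀ j < A.n, A.dist C j < A.Z) : A.total C < A.Z := by
  have h1 : A.total C ≤ ∑ p ∈ I.edges, I.cost p.1 p.2 := by
    rw [CostMatrix.total, hA.n, Finset.sum_range,
      ← Finset.sum_fiberwise_of_maps_to (s := I.edges) (t := Finset.univ) (g := Prod.snd)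
        fun _ _ => Finset.mem_univ _]
    refine Finset.sum_le_sum fun j _ => ?_
    have hj := h j (by rw [hA.n]; exact j.2)
    rcases A.dist_eq_Z_or C j with h' | ⟨x, -, h'⟩
    · exact absurd h' hj.ne
    · rw [h'] at hj ⊢
      obtain ⟨p, hp, rfl, hpj⟩ := hA.exists_edge hj
      obtain rfl : p.2 = j := Fin.ext hpj
      rw [hA.c_eq hp]
      exact Finset.single_le_sum (f := fun p => I.cost p.1 p.2)
        (fun q hq => I.cost_nonneg q (Finset.mem_filter.1 hq).1)
        (Finset.mem_filter.2 ⟨hp, rfl⟩ : p ∈ I.edges.filter (fun q => q.2 = p.2))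
  rw [hA.Z, bigCost]
  linarith

lemma Represents.dist_nonneg (C : Finset ℕ) (j : ℕ) : 0 ≤ A.dist C j := by
  rw [CostMatrix.dist, Finset.le_fold_min, hA.Z, hA.c]
  exact ⟨I.bigCost_pos.le, fun x _ => I.fullCost_nonneg x j⟩

/-- Against an infeasible competitor there is nothing to show. Otherwise the total of `C` is below
`Z`, and as distances are nonnegative each single one is too, so `C` is feasible as well. -/
lemma Represents.setCost_le {D' : Finset (Fin I.centers)} {C' : Finset ℕ}
    (hCD : ∀ i : Fin I.centers, i ∈ D ↔ (i : ℕ) ∈ C)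
    (hCD' : ∀ i : Fin I.centers, i ∈ D' ↔ (i : ℕ) ∈ C')
    (h : (∀ j < A.n, A.dist C' j < A.Z) → A.total C ≤ A.total C') :
    I.setCost D ≤ I.setCost D' := by
  by_cases hfeas : ∀ j < A.n, A.dist C' j < A.Z
  · have hlt := (h hfeas).trans_lt (hA.total_lt hfeas)
    rw [hA.setCost_eq hCD' hfeas, hA.setCost_eq hCD]
    · exact WithTop.coe_le_coe.2 (h hfeas)
    · intro j hj
      exact (Finset.single_le_sum (f := A.dist C) (fun i _ => hA.dist_nonneg C i)
        (Finset.mem_range.2 hj)).trans_lt hlt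
  · push Not at hfeas
    obtain ⟨j, hj, hZ⟩ := hfeas
    rw [hA.setCost_eq_top (j := ⟨j, hA.n ▸ hj⟩) hCD' hZ.not_gt]
    exact le_top

end KMedian

namespace KMedian

open FieldRAM

/-- The program is a polynomial-time approximation algorithm for unit costs, over every ordered
field. -/
theorem program_sizeApproximates (K : Type) [Field K] [LinearOrder K] [IsStrictOrderedRing K] :
    SizeApproximates program kMedianAlpha (unitPricing K) size
      (Polynomial.C program.weight * (Polynomial.X + 1) ^ 8) := by
  intro I k enum hk hn hkn
  have hkn' : k ≤ I.customers := by omega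
  suffices h : Halts I.size 8 program (I.input k enum) (fun s' =>
      I.IsSizeApproxSolution k (kMedianAlpha k I.customers) (I.output s')) by
    obtain ⟨t, s', hr, ht, hsol⟩ := h
    exact ⟨t, s', hr, by simpa using ht, hsol⟩
  set s := I.input k enum with hs
  let m := I.edges.card
  have hU : s.nat 0 0 = I.centers := rfl
  have hn0 : s.nat 0 1 = I.customers := rfl
  have hm0 : s.nat 0 2 = m := rfl
  have hk0 : s.nat 0 3 = k := rfl
  have hsize : I.size = I.centers + I.customers + m := rfl
  have hedge : ∀ e (he : e < m), s.nat 1 e = (enum ⟨e, he⟩ : Fin I.centers × Fin I.customers).1 ∧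
      s.nat 2 e = (enum ⟨e, he⟩ : Fin I.centers × Fin I.customers).2 ∧
      s.fld 0 e = I.cost (enum ⟨e, he⟩ : Fin I.centers × Fin I.customers).1
        (enum ⟨e, he⟩ : Fin I.centers × Fin I.customers).2 := by
    intro e he
    simp only [hs, input]
    exact ⟨by rw [dif_pos he], by rw [dif_pos he], by rw [dif_pos he]⟩
  have hedge' : ∀ p ∈ I.edges, ∃ e < m, s.nat 1 e = p.1 ∧ s.nat 2 e = p.2 ∧
      s.fld 0 e = I.cost p.1 p.2 := by
    intro p hp
    refine ⟨enum.symm ⟨p, hp⟩, Fin.is_lt _, ?_⟩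
    simpa using hedge (enum.symm ⟨p, hp⟩) (Fin.is_lt _)
  have hZ : 1 + ∑ e ∈ Finset.range m, s.fld 0 e = I.bigCost := by
    rw [bigCost, Finset.sum_range, ← Finset.sum_coe_sort I.edges, ← Equiv.sum_comp enum]
    congr 1
    exact Finset.sum_congr rfl fun e _ => (hedge e e.2).2.2
  have hc : ∀ e < m, I.fullCost I.bigCost (s.nat 1 e) (s.nat 2 e) = s.fld 0 e := by
    intro e he
    obtain ⟨h1, h2, h3⟩ := hedge e he
    rw [h1, h2, h3, I.fullCost_of_mem _ (enum ⟨e, he⟩).2]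
  have hcases : ∀ x j, (∃ e < m, s.nat 1 e = x ∧ s.nat 2 e = j) ∨
      I.fullCost I.bigCost x j = I.bigCost := by
    intro x j
    rcases I.fullCost_cases I.bigCost x j with ⟨p, hp, rfl, rfl⟩ | h
    · obtain ⟨e, he, h1, h2, -⟩ := hedge' p hp
      exact Or.inl ⟨e, he, h1, h2⟩
    · exact Or.inr h
  have hcost : ∀ e < m, s.fld 0 e + 1 ≤ I.bigCost := by
    intro e he
    rw [(hedge e he).2.2]
    exact I.cost_add_one_le (enum ⟨e, he⟩).2
  refine Halts.seq ((halts_prepare hn0 hm0 (B := I.size) (by omega) (by omega) ?_).mono_exp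
    (by omega)) fun s₁ hf₁ h₁ => ?_
  · intro e he
    rw [hZ]
    linarith [hcost e he]
  rw [hZ] at h₁
  obtain ⟨hZ₁, h9₁, hlow₁⟩ := h₁
  have h0₁ : s₁.nat 0 = s.nat 0 := hf₁.nat 0 (by decide)
  refine Halts.seq ((halts_countSteps (by rw [h0₁, hn0]) (by rw [h0₁, hk0]) (by omega) hk
    hkn').mono_exp (by omega)) fun s₂ hf₂ h₂ => ?_
  obtain ⟨ht₂, hpow₂⟩ := h₂
  let A : CostMatrix K :=
    { n := I.customers
      c := I.fullCost I.bigCost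
      Z := I.bigCost
      low := s₁.fld 2
      best := s₁.nat 4
      c_le := I.fullCost_le
      low_le := by
        intro x j hj
        obtain ⟨hle, hor⟩ := hlow₁ j hj
        rcases hcases x j with ⟨e, he, rfl, rfl⟩ | h
        · rw [hc e he]
          exact hle e he rfl
        · rw [h]
          rcases hor with ⟨h1, -⟩ | ⟨e, he, -, -, h1⟩
          · exact h1.le
          · rw [← h1]
            linarith [hcost e he]
      c_best := by
        intro j hj
        rcases (hlow₁ j hj).2 with ⟨h1, h2⟩ | ⟨e, he, rfl, h1, h2⟩
        · rw [h1]
          refine (hcases _ j).resolve_left ?_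
          rintro ⟨e, he, -, h3⟩
          exact h2 e he h3
        · rw [← h1, ← h2, hc e he] }
  have hA : I.Represents A := ⟨rfl, rfl, rfl⟩
  let S : Setup K :=
    { A with
      U := I.centers
      m := m
      k := k
      t := s₂.nat 6 0
      B := I.size
      ctr := s.nat 1
      cust := s.nat 2
      cost := s.fld 0
      U_le := by omega
      n_pos := hn
      n_le := show I.customers ≤ I.size by omega
      m_le := by omega
      t_le := by
        have h1 := kMedianT_le hk hn hkn'
        have h2 : I.customers ^ 3 ≤ (I.size + 1) ^ 3 := Nat.pow_le_pow_left (by omega) 3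
        omega
      cust_lt := fun e he => by rw [(hedge e he).2.1]; exact Fin.is_lt _
      c_edge := hc
      c_cases := hcases }
  have hS : S.Agrees s₂ :=
    { U := by rw [hf₂.nat 0 (by decide), h0₁]; rfl
      n := by rw [hf₂.nat 0 (by decide), h0₁]; rfl
      m := by rw [hf₂.nat 0 (by decide), h0₁]; rfl
      k := by rw [hf₂.nat 0 (by decide), h0₁]; rfl
      t := rfl
      ctr := by rw [hf₂.nat 1 (by decide), hf₁.nat 1 (by decide)]
      cust := by rw [hf₂.nat 2 (by decide), hf₁.nat 2 (by decide)]
      best := hf₂.nat 4 (by decide)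
      cost := by rw [hf₂.fld 0 (by decide), hf₁.fld 0 (by decide)]
      low := hf₂.fld 2 (by decide)
      Z := (congrFun (hf₂.fld 1 (by decide)) 0).trans hZ₁ }
  have hdone : S.Done (fun _ => False) s₂ := by
    refine ⟨∅, by simp, ⟨?_, fun x _ => ?_⟩, fun _ h => h.elim⟩
    · rw [hf₂.fld 9 (by decide), h9₁]
      simp [CostMatrix.total, CostMatrix.dist_empty, S, A]
    · rw [hf₂.nat 3 (by decide), hf₁.nat 3 (by decide)]
      simp [hs, input]
  refine (halts_search hS hdone).imp fun s₃ _ h₃ => ?_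
  obtain ⟨C, hcard, hkept, hbest⟩ := h₃
  have hout : ∀ i : Fin I.centers, i ∈ I.output s₃ ↔ (i : ℕ) ∈ C := fun i => by
    rw [output, Finset.mem_filter, ← hkept.mem i i.2]
    simp
  refine ⟨?_, fun D hD => ?_⟩
  · refine le_trans ?_ (size_le_kMedianAlpha hk hn hkn ht₂)
    have h1 : (I.output s₃).card ≤ C.card := Finset.card_le_card_of_injOn (fun i => (i : ℕ))
      (fun i hi => (hout i).1 hi) (fun i _ j _ h => Fin.ext h)
    exact_mod_cast h1.trans hcard
  · refine hA.setCost_le (C' := D.map Fin.valEmbedding) hout (fun i => ?_) fun hfeas => ?_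
    · constructor
      · exact fun hi => Finset.mem_map.2 ⟨i, hi, rfl⟩
      · intro hi
        obtain ⟨i', hi', h⟩ := Finset.mem_map.1 hi
        exact Fin.ext h ▸ hi'
    have hless : ∀ x j, A.c x j < A.Z → ∃ e < m, s.nat 1 e = x ∧ s.nat 2 e = j :=
      fun x j h => (hcases x j).resolve_right h.ne
    have hval : ∀ x, ∀ j < A.n, A.c x j < A.Z → ∃ e < m, S.unit e = A.c x j - A.low j := by
      intro x j _ h
      obtain ⟨e, he, rfl, rfl⟩ := hless x j h
      refine ⟨e, he, ?_⟩
      rw [Setup.unit, if_pos he]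
      exact congrArg (· - _) (hc e he).symm
    have hgap : ∀ x, ∀ j < A.n, A.c x j < A.Z → A.c x j + 1 ≤ A.Z := by
      intro x j _ h
      obtain ⟨e, he, rfl, rfl⟩ := hless x j h
      exact (congrArg (· + 1) (hc e he)).le.trans (hcost e he)
    have hDU : ∀ y ∈ D.map Fin.valEmbedding, y < I.centers := by
      intro y hy
      obtain ⟨i, -, rfl⟩ := Finset.mem_map.1 hy
      exact i.2
    -- The good cap depends on `D`, but the output is at least as cheap as some candidate for every
    -- cap tried, and the good cap works however ties were broken.
    obtain ⟨e, he, r, hr1, hr2, hgood⟩ := A.exists_good_cap (t := S.t) hval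
      (if_neg (lt_irrefl m)) hgap hDU (by rw [Finset.card_map, hD]) hk hfeas hpow₂
    obtain ⟨C', ⟨C₀, hgr, hfill⟩, hle⟩ := hbest _ ⟨e, he, r, hr1, hr2, rfl⟩
    exact hle.trans (hgood C₀ C' hgr hfill)

end KMedian

/-- A single program is an `α_{kn}`-size-approximation algorithm for `k`-Median that takes
polynomially many operations for arbitrary real costs, and polynomial time in the bit model
for rational costs. -/
theorem mainTheorem4 :
    ∃ (A : FieldRAM.Prog) (P : Polynomial ℕ),
      KMedian.SizeApproximates A kMedianAlpha (FieldRAM.unitPricing ℝ) KMedian.size P ∧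
      KMedian.SizeApproximates A kMedianAlpha FieldRAM.bitPricing KMedian.bitSize P := by
  obtain ⟨Q, hle, hQ⟩ := KMedian.SizeApproximates.exists_bit KMedian.program_linear
    (KMedian.program_sizeApproximates ℚ)
  refine ⟨KMedian.program, Q, fun I k enum hk hn hkn => ?_, hQ⟩
  obtain ⟨t, s, hrun, ht, hsol⟩ := KMedian.program_sizeApproximates ℝ I k enum hk hn hkn
  exact ⟨t, s, hrun, ht.trans (hle _), hsol⟩
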